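/- Let $n\ge 1$, $[n]=\{1,\dots,n\}$. A building set $\mathcal B$ on $[n]$ is a collection of nonempty subsets of $[n]$ that contains all singletons and satisfies $I\cup J\in\mathcal B$ whenever $I,J\in\mathcal B$ and $I\cap J\neq\varnothing$. Let $x_1,\dots,x_n$ be formal symbols. The extended nested complex $\mathcal N^{\square}(\mathcal B)$ is the abstract simplicial complex on the vertex set $\mathcal B\cup\{x_1,\dots,x_n\}$ whose faces are the sets $\{I_1,\dots,I_m\}\cup\{x_{i_1},\dots,x_{i_r}\}$ with $I_j\in\mathcal B$ such that (1) any two of the $I_j$ are disjoint or one contains the other, (2) the union of any $k\ge 2$ distinct pairwise disjoint $I_j$'s is not in $\mathcal B$, and (3) $i_\ell\notin I_j$ for all $\ell,j$. The stellar subdivision of a simplicial complex $\Delta$ on a face $F$ with new vertex $v$ is $(\Delta\setminus \mathrm{Cl}\,\mathrm{St}_\Delta(F))\cup(\{v\}*\partial F*\mathrm{Lk}_\Delta(F))$. For a full-dimensional simplicial polytope $P\subset\mathbb R^n$ and a proper face $F$ of $P$, a (geometric) stellar subdivision of $P$ on $F$ is a polytope $\mathrm{Conv}(P\cup\{v\})$,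 where $v$ is a point that lies beyond every facet of $P$ containing $F$ (strictly on the other side of the facet hyperplane from the interior of $P$) and beneath every other facet (strictly on the same side as the interior of $P$). **Theorem.** For every building set $\mathcal B$ on $[n]$, the complex $\mathcal N^{\square}(\mathcal B)$ is isomorphic to the boundary complex of an $n$-dimensional simplicial polytope. Moreover, such a polytope is obtained as follows. Start with the cross polytope in $\mathbb R^n$, with vertex $e_i$ labelled $\{i\}$ and vertex $-e_i$ labelled $x_i$. List the non-singletons of $\mathcal B$ in any order of (weakly) decreasing cardinality, and for each $I$ in this order perform a stellar subdivision on the face with vertex labels $\{\{i\} : i\in I\}$, labelling the new vertex $I$. Then: 1. every step can be carried out, whatever new vertices were chosen before: $\{\{i\}: i\in I\}$ is a face of the current complex, $I$ is not yet a label, and an admissible new point exists; 2. every intermediate polytope is an $n$-dimensional simplicial polytope whose boundary complex, with the labels of its vertices, is the corresponding iterated stellar subdivision of the boundary complex of the cross polytope; 3. the complex obtained after the last step is $\mathcal N^{\square}(\mathcal B)$, so that for every choice of the new vertices the labelling of the vertices is an isomorphism from $\mathcal N^{\square}(\mathcal B)$ to the boundary complex of the final $n$-dimensional simplicial polytope.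 -/

import Mathlib

namespace ExtNested

/-! ### Building sets and abstract simplicial complexes -/

/-- A building set on a finite set `S`. -/
structure IsBuildingSet {S : Type} [DecidableEq S] (B : Finset (Finset S)) : Prop where
  nonempty : ∀ I ∈ B, I.Nonempty
  singleton_mem : ∀ i : S, {i} ∈ B
  union_mem : ∀ I ∈ B, ∀ J ∈ B, (I ∩ J).Nonempty → I ∪ J ∈ B

/-- An abstract simplicial complex: a family of finite sets closed under taking subsets
(the empty set counts as a face). -/
@[ext]
structure FaceComplex (V : Type) where
  faces : Set (Finset V)
  down_closed : ∀ X ∈ faces, ∀ Y ⊆ X, Y ∈ faces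

namespace FaceComplex

variable {V : Type} [DecidableEq V]

/-- The vertices of a complex. -/
def vertices (Δ : FaceComplex V) : Set V := {v | {v} ∈ Δ.faces}

/-- The open star `St F`. -/
def star (Δ : FaceComplex V) (F : Finset V) : Set (Finset V) := {G ∈ Δ.faces | F ⊆ G}

/-- The closed star `Cl St F`. -/
def closedStar (Δ : FaceComplex V) (F : Finset V) : Set (Finset V) :=
  {H ∈ Δ.faces | ∃ G ∈ Δ.star F, H ⊆ G}

/-- The link `Lk F`. -/
def link (Δ : FaceComplex V) (F : Finset V) : Set (Finset V) :=
  {G ∈ Δ.faces | F ∩ G = ∅ ∧ F ∪ G ∈ Δ.faces}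

/-- The stellar subdivision `(Δ \ Cl St F) ∪ ({v} * ∂F * Lk F)` of `Δ` on the face `F`, with new
vertex `v`. -/
def stellarSubdivision (Δ : FaceComplex V) (F : Finset V) (v : V) : FaceComplex V where
  faces := (Δ.faces \ Δ.closedStar F) ∪
    {X | ∃ A T G : Finset V, A ⊆ {v} ∧ T ⊂ F ∧ G ∈ Δ.link F ∧ X = A ∪ T ∪ G}
  down_closed := by
    rintro X (⟨hX, hXs⟩ | ⟨A, T, G, hA, hT, ⟨hG, hFG, hFGf⟩, rfl⟩) Y hY
    · by_cases hYs : Y ∈ Δ.closedStar F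
      · right
        obtain ⟨hYf, K, ⟨hK, hFK⟩, hYK⟩ := hYs
        refine ⟨∅, Y ∩ F, Y \ F, by simp, ?_, ⟨?_, ?_, ?_⟩, ?_⟩
        · refine Finset.ssubset_iff_subset_ne.2 ⟨Finset.inter_subset_right, fun h => hXs ?_⟩
          have hFY : F ⊆ Y := by
            rw [← h]
            exact Finset.inter_subset_left
          exact ⟨hX, X, ⟨hX, hFY.trans hY⟩, subset_rfl⟩
        · exact Δ.down_closed _ hYf _ Finset.sdiff_subset
        · ext a
          simp
        · exact Δ.down_closed _ hK _
            (Finset.union_subset hFK (Finset.sdiff_subset.trans hYK))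
        · ext a
          simp only [Finset.mem_union, Finset.mem_inter, Finset.mem_sdiff, Finset.notMem_empty]
          tauto
      · exact Or.inl ⟨Δ.down_closed _ hX _ hY, hYs⟩
    · right
      refine ⟨Y ∩ A, Y ∩ T, Y ∩ G, Finset.inter_subset_right.trans hA,
        Finset.ssubset_of_subset_of_ssubset Finset.inter_subset_right hT,
        ⟨Δ.down_closed _ hG _ Finset.inter_subset_right, ?_, ?_⟩, ?_⟩
      · refine Finset.subset_empty.1 ?_
        rw [← hFG]
        exact Finset.inter_subset_inter subset_rfl Finset.inter_subset_right
      · exact Δ.down_closed _ hFGf _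
          (Finset.union_subset_union subset_rfl Finset.inter_subset_right)
      · rw [← Finset.inter_union_distrib_left, ← Finset.inter_union_distrib_left]
        exact (Finset.inter_eq_left.2 hY).symm

end FaceComplex

/-! ### Extended nested collections -/

/-- Vertex labels: `Sum.inl I` stands for the subset `I`, and `Sum.inr i` for the design
vertex `x_i`. -/
abbrev Label (S : Type) : Type := Finset S ⊕ S

/-- Extended nested collections of `B`. The maximal elements of `B` are allowed as members. -/
structure IsExtendedNested {S : Type} [DecidableEq S] (B : Finset (Finset S))
    (N : Finset (Label S)) : Prop where
  mem : ∀ I, Sum.inl I ∈ N → I ∈ B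
  nested_or_disjoint : ∀ I J, Sum.inl I ∈ N → Sum.inl J ∈ N → I ⊆ J ∨ J ⊆ I ∨ I ∩ J = ∅
  union_not_mem : ∀ C : Finset (Finset S), 2 ≤ C.card → (∀ I ∈ C, Sum.inl I ∈ N) →
    (∀ I ∈ C, ∀ J ∈ C, I ≠ J → I ∩ J = ∅) → C.biUnion id ∉ B
  design : ∀ i I, Sum.inr i ∈ N → Sum.inl I ∈ N → i ∉ I

/-- The extended nested complex of `B`. -/
def extendedNestedComplex {S : Type} [DecidableEq S] (B : Finset (Finset S)) :
    FaceComplex (Label S) where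
  faces := {N | IsExtendedNested B N}
  down_closed := fun _ hX _ hY =>
    { mem := fun I hI => hX.mem I (hY hI)
      nested_or_disjoint := fun I J hI hJ => hX.nested_or_disjoint I J (hY hI) (hY hJ)
      union_not_mem := fun C hC hCY hd =>
        hX.union_not_mem C hC (fun I hI => hY (hCY I hI)) hd
      design := fun i I hi hI => hX.design i I (hY hi) (hY hI) }

/-! ### Polytopes -/

/-- A proper face of a polytope `P` in `ℝⁿ` (the empty set is a proper face of a nonempty
polytope). -/
def IsProperFace {n : ℕ} (P F : Set (Fin n → ℝ)) : Prop := IsExposed ℝ P F ∧ F ≠ P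

/-- The dimension of the affine span of a set. -/
noncomputable def dim {n : ℕ} (P : Set (Fin n → ℝ)) : ℕ := Module.finrank ℝ (vectorSpan ℝ P)

/-- A facet of `P`: a nonempty face of dimension `dim P - 1`. -/
def IsFacet {n : ℕ} (P F : Set (Fin n → ℝ)) : Prop :=
  IsExposed ℝ P F ∧ F.Nonempty ∧ dim F + 1 = dim P

/-- A simplicial polytope: the convex hull of finitely many points, all of whose proper faces are
simplices. -/
def IsSimplicialPolytope {n : ℕ} (P : Set (Fin n → ℝ)) : Prop :=
  (∃ s : Finset (Fin n → ℝ), P = convexHull ℝ (s : Set (Fin n → ℝ))) ∧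
  ∀ F, IsProperFace P F → ∃ t : Finset (Fin n → ℝ),
    AffineIndependent ℝ (fun x : t => (x : Fin n → ℝ)) ∧
      F = convexHull ℝ (t : Set (Fin n → ℝ))

/-- The map `φ` is an isomorphism from the complex `Δ` to the boundary complex of the simplicial
polytope `P`. -/
structure IsGeometricRealization {V : Type} {n : ℕ} (Δ : FaceComplex V) (P : Set (Fin n → ℝ))
    (φ : V → Fin n → ℝ) : Prop where
  simplicial : IsSimplicialPolytope P
  vertices : Set.BijOn φ Δ.vertices (P.extremePoints ℝ)
  faces : ∀ σ : Finset V, (σ : Set V) ⊆ Δ.vertices →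
    (σ ∈ Δ.faces ↔ IsProperFace P (convexHull ℝ (φ '' (σ : Set V))))

/-- The point `p` lies beyond the facet `F` of the full-dimensional polytope `P`: the hyperplane
spanned by `F` strictly separates `p` from the interior of `P`. -/
def IsBeyond {n : ℕ} (P F : Set (Fin n → ℝ)) (p : Fin n → ℝ) : Prop :=
  ∃ (l : StrongDual ℝ (Fin n → ℝ)) (c : ℝ),
    (∀ x ∈ P, l x ≤ c) ∧ F = {x ∈ P | l x = c} ∧ c < l p

/-- The point `p` lies beneath the facet `F` of the full-dimensional polytope `P`: `p` lies strictly
on the same side of the hyperplane spanned by `F` as the interior of `P`. -/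
def IsBeneath {n : ℕ} (P F : Set (Fin n → ℝ)) (p : Fin n → ℝ) : Prop :=
  ∃ (l : StrongDual ℝ (Fin n → ℝ)) (c : ℝ),
    (∀ x ∈ P, l x ≤ c) ∧ F = {x ∈ P | l x = c} ∧ l p < c

/-! ### The construction -/

/-- A finite set of labels together with the points of `ℝⁿ` that they label. -/
structure LabelledPoints (V : Type) (n : ℕ) where
  labels : Finset V
  point : V → Fin n → ℝ

namespace LabelledPoints

variable {V : Type} [DecidableEq V] {n : ℕ}

/-- The convex hull of the points with a label in `σ`. -/
def hull (P : LabelledPoints V n) (σ : Finset V) : Set (Fin n → ℝ) :=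
  convexHull ℝ (P.point '' (σ : Set V))

/-- The convex hull of all the labelled points. -/
def polytope (P : LabelledPoints V n) : Set (Fin n → ℝ) := P.hull P.labels

/-- Add the point `p` with label `v`; the polytope becomes `Conv (P ∪ {p})`. -/
def addVertex (P : LabelledPoints V n) (v : V) (p : Fin n → ℝ) : LabelledPoints V n where
  labels := insert v P.labels
  point := Function.update P.point v p

/-- Adding `p` is a stellar subdivision of the polytope on the face with vertex labels `σ`: the
hull of `σ` is a proper face, and `p` lies beyond the facets that contain this face and beneath all
the other facets. -/
def IsStellarPoint (P : LabelledPoints V n) (σ : Finset V) (p : Fin n → ℝ) : Prop :=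
  IsProperFace P.polytope (P.hull σ) ∧
  ∀ G, IsFacet P.polytope G →
    (P.hull σ ⊆ G → IsBeyond P.polytope G p) ∧ (¬ P.hull σ ⊆ G → IsBeneath P.polytope G p)

end LabelledPoints

/-- The cross polytope, with `e_i` labelled `{i}` and `-e_i` labelled `x_i`. (The value of `point`
at subsets that are not singletons is irrelevant.) -/
def crossPolytope (n : ℕ) : LabelledPoints (Label (Fin n)) n where
  labels := Finset.univ.image (fun i => Sum.inl {i}) ∪ Finset.univ.image Sum.inr
  point
    | Sum.inl I => fun j => if I = {j} then 1 else 0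
    | Sum.inr i => -Pi.single i 1

theorem crossPolytope_point_inl {n : ℕ} (i : Fin n) :
    (crossPolytope n).point (Sum.inl {i}) = Pi.single i 1 := by
  funext j
  simp [crossPolytope, Pi.single_apply, eq_comm]

/-- The boundary complex of the cross polytope: sets of labels `{i}`, `x_i` that do not contain
both `{i}` and `x_i` for any `i`. -/
def crossComplex (n : ℕ) : FaceComplex (Label (Fin n)) where
  faces := {σ | (∀ I, Sum.inl I ∈ σ → ∃ i, I = {i}) ∧
    ∀ i : Fin n, ¬ (Sum.inl ({i} : Finset (Fin n)) ∈ σ ∧ Sum.inr i ∈ σ)}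
  down_closed := fun _ hX _ hY =>
    ⟨fun I hI => hX.1 I (hY hI), fun i h => hX.2 i ⟨hY h.1, hY h.2⟩⟩

/-- The set of labels `{{i} : i ∈ I}`. -/
def singletonFace {n : ℕ} (I : Finset (Fin n)) : Finset (Label (Fin n)) :=
  I.image (fun i => Sum.inl {i})

/-- The complex obtained from the boundary complex of the cross polytope by successive stellar
subdivisions on the faces `{{i} : i ∈ I}`, with new vertex `I`, for the members `I` of `L` in the
order of the list. -/
def iteratedSubdivision {n : ℕ} (L : List (Finset (Fin n))) : FaceComplex (Label (Fin n)) :=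
  L.foldl (fun Δ I => Δ.stellarSubdivision (singletonFace I) (Sum.inl I)) (crossComplex n)

/-- `IsStellarRun L P`: the labelled polytope `P` arises from the cross polytope by successive
stellar subdivisions on the faces `{{i} : i ∈ I}`, with a new vertex labelled `I`, for the members
`I` of `L` in the order of the list. -/
inductive IsStellarRun {n : ℕ} :
    List (Finset (Fin n)) → LabelledPoints (Label (Fin n)) n → Prop
  | nil : IsStellarRun [] (crossPolytope n)
  | snoc {L : List (Finset (Fin n))} {P : LabelledPoints (Label (Fin n)) n}
      {I : Finset (Fin n)} {p : Fin n → ℝ} (hP : IsStellarRun L P)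
      (hp : P.IsStellarPoint (singletonFace I) p) :
      IsStellarRun (L ++ [I]) (P.addVertex (Sum.inl I) p)

/-- `L` lists the non-singletons of `B`, each once, by (weakly) decreasing cardinality. -/
structure IsDecreasingOrder {n : ℕ} (B : Finset (Finset (Fin n))) (L : List (Finset (Fin n))) :
    Prop where
  nodup : L.Nodup
  mem_iff : ∀ I, I ∈ L ↔ I ∈ B ∧ I.card ≠ 1
  decreasing : L.Pairwise (fun I J => J.card ≤ I.card)

end ExtNested

open ExtNested

/-! The proof has a combinatorial and a geometric half, joined by an induction along the list of
non-singletons.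

Combinatorics. Let `B` and `B ∪ {I}` be building sets, with `I ∉ B`, `|I| ≥ 2`, and every member of
`B` inside `I` a singleton. Then passing from the complex of `B` to that of `B ∪ {I}` is the stellar
subdivision on the singletons of `I` (`stellarSubdivision_extendedNestedComplex`). Those singletons
become a forbidden set, and in every union the new vertex `I` can be traded for them. Decreasing
cardinality provides the hypotheses at each step: the union of two crossing members is larger than
both, so it was listed before them, and no proper subset of `I` with at least two elements precedes
`I`. With singletons alone, the complex is that of the cross polytope.

Geometry. Everything is read off the polar dual. When the origin is interior, the proper faces of
the polytope are the hulls of the active sets `{v : l v = 1}` for `l` in the dual body, and facets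
correspond to those `l` whose active points span. The dual body is the convex hull of these finitely
many normals (`dualBody_eq_convexHull`). The active set of a proper convex combination is the
intersection of the two active sets, so beyond/beneath conditions on facets spread to all faces
(`dualBody_induction`). Adding `p` cuts the dual body by the half-space `l p ≤ 1`; comparing active
sets before and after gives the stellar subdivision (`Realizes.addVertex`). A point slightly outside
the barycentre of the face is always admissible. -/

namespace ExtNested

/-! ### Stellar subdivisions of complexes -/

/-- A description of the faces of a stellar subdivision with a genuinely new vertex. -/
theorem FaceComplex.mem_stellarSubdivision_iff {V : Type} [DecidableEq V] {Δ : FaceComplex V}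
    {F X : Finset V} {v : V} (hF : F ∈ Δ.faces) (hv : v ∉ Δ.vertices) :
    X ∈ (Δ.stellarSubdivision F v).faces ↔
      ¬ F ⊆ X ∧ ((v ∉ X ∧ X ∈ Δ.faces) ∨ (v ∈ X ∧ F ∪ X.erase v ∈ Δ.faces)) := by
  have hnot : ∀ Y ∈ Δ.faces, v ∉ Y := fun Y hY hvY =>
    hv (Δ.down_closed Y hY {v} (Finset.singleton_subset_iff.2 hvY))
  constructor
  · rintro (⟨hX, hXs⟩ | ⟨A, T, G, hA, hT, ⟨hG, hFG, hFGf⟩, rfl⟩)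
    · exact ⟨fun h => hXs ⟨hX, X, ⟨hX, h⟩, subset_rfl⟩, Or.inl ⟨hnot X hX, hX⟩⟩
    · have hFG' : ∀ a ∈ F, a ∉ G := fun a ha haG => by
        have : a ∈ F ∩ G := Finset.mem_inter.2 ⟨ha, haG⟩
        simp [hFG] at this
      have hTG : T ∪ G ∈ Δ.faces := Δ.down_closed _ hFGf _ (Finset.union_subset_union hT.1 subset_rfl)
      refine ⟨fun h => hT.2 fun a ha => ?_, ?_⟩
      · rcases Finset.mem_union.1 (h ha) with h' | h'
        · rcases Finset.mem_union.1 h' with h'' | h''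
          · exact absurd (Finset.mem_singleton.1 (hA h'') ▸ ha) (hnot F hF)
          · exact h''
        · exact absurd h' (hFG' a ha)
      · rcases Finset.subset_singleton_iff.1 hA with rfl | rfl
        · rw [Finset.empty_union]
          exact Or.inl ⟨hnot _ hTG, hTG⟩
        · refine Or.inr ⟨by simp, ?_⟩
          refine Δ.down_closed _ hFGf _ fun a ha => ?_
          have := hT.1
          simp only [Finset.mem_union, Finset.mem_erase, Finset.mem_singleton] at ha ⊢
          rcases ha with ha | ⟨h1, (h2 | h2) | h2⟩
          · exact Or.inl ha
          · exact absurd h2 h1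
          · exact Or.inl (this h2)
          · exact Or.inr h2
  -- The splitting of `Y` into its part inside `F` and its part in the link.
  · have key : ∀ Y : Finset V, ¬ F ⊆ Y → F ∪ Y ∈ Δ.faces → Y ∩ F ⊂ F ∧ Y \ F ∈ Δ.link F := by
      intro Y hFY hY
      refine ⟨Finset.ssubset_iff_subset_ne.2 ⟨Finset.inter_subset_right, fun h => hFY ?_⟩,
        Δ.down_closed _ hY _ (Finset.sdiff_subset.trans Finset.subset_union_right), by simp, ?_⟩
      · rw [← h]
        exact Finset.inter_subset_left
      · rwa [Finset.union_sdiff_self_eq_union]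
    rintro ⟨hFX, ⟨-, hX⟩ | ⟨hvX, hX⟩⟩
    · by_cases hXs : X ∈ Δ.closedStar F
      · obtain ⟨-, K, ⟨hK, hFK⟩, hXK⟩ := hXs
        obtain ⟨h1, h2⟩ := key X hFX (Δ.down_closed _ hK _ (Finset.union_subset hFK hXK))
        refine Or.inr ⟨∅, _, _, by simp, h1, h2, ?_⟩
        ext a
        simp only [Finset.mem_union, Finset.mem_inter, Finset.mem_sdiff, Finset.notMem_empty]
        tauto
      · exact Or.inl ⟨hX, hXs⟩
    · obtain ⟨h1, h2⟩ := key (X.erase v)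
        (fun h => hFX (h.trans (Finset.erase_subset _ _))) hX
      refine Or.inr ⟨{v}, _, _, subset_rfl, h1, h2, ?_⟩
      ext a
      simp only [Finset.mem_union, Finset.mem_inter, Finset.mem_sdiff, Finset.mem_singleton,
        Finset.mem_erase]
      by_cases hav : a = v
      · simp [hav, hvX]
      · simp only [hav]
        tauto

/-! ### Adding a set to a building set -/

variable {n : ℕ} {B : Finset (Finset (Fin n))} {I : Finset (Fin n)}

@[simp]
theorem inl_mem_singletonFace {I J : Finset (Fin n)} :
    (Sum.inl J : Label (Fin n)) ∈ singletonFace I ↔ ∃ i ∈ I, {i} = J := by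
  simp [singletonFace]

@[simp]
theorem inr_notMem_singletonFace {I : Finset (Fin n)} {i : Fin n} :
    (Sum.inr i : Label (Fin n)) ∉ singletonFace I := by
  simp [singletonFace]

theorem card_singletonFace (I : Finset (Fin n)) : (singletonFace I).card = I.card :=
  Finset.card_image_of_injective _ fun i j h => by simpa using h

theorem biUnion_image_singleton (I : Finset (Fin n)) :
    (I.image fun i => ({i} : Finset (Fin n))).biUnion id = I := by
  ext a
  simp

theorem card_image_singleton (I : Finset (Fin n)) :
    (I.image fun i => ({i} : Finset (Fin n))).card = I.card :=
  Finset.card_image_of_injective _ Finset.singleton_injective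

theorem IsExtendedNested.not_singletonFace_subset {X : Finset (Label (Fin n))}
    (hX : IsExtendedNested B X) (hI : I ∈ B) (hcard : 2 ≤ I.card) : ¬ singletonFace I ⊆ X := by
  intro h
  refine hX.union_not_mem (I.image fun i => {i}) (by rwa [card_image_singleton]) ?_ ?_
    (by rwa [biUnion_image_singleton])
  · intro J hJ
    obtain ⟨i, hi, rfl⟩ := Finset.mem_image.1 hJ
    exact h (by simpa using hi)
  · intro J hJ K hK hne
    obtain ⟨i, hi, rfl⟩ := Finset.mem_image.1 hJ
    obtain ⟨j, hj, rfl⟩ := Finset.mem_image.1 hK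
    rw [← Finset.disjoint_iff_inter_eq_empty, Finset.disjoint_singleton]
    rintro rfl
    exact hne rfl

/-- If all members of `C` are subsets of `I` that belong to `B`, hence singletons, and they cover
`I`, then all the singletons of `I` are in `C`. -/
theorem singletonFace_subset_of_biUnion_eq {X : Finset (Label (Fin n))}
    {C : Finset (Finset (Fin n))} (hmin : ∀ J ∈ B, J ⊆ I → J.card = 1)
    (hCX : ∀ J ∈ C, Sum.inl J ∈ X) (hCB : ∀ J ∈ C, J ∈ B) (hU : C.biUnion id = I) :
    singletonFace I ⊆ X := by
  intro a ha
  obtain ⟨i, hi, rfl⟩ := Finset.mem_image.1 ha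
  have hi' := hi
  rw [← hU, Finset.mem_biUnion] at hi'
  obtain ⟨J, hJ, hiJ⟩ := hi'
  have hJI : J ⊆ I := by
    rw [← hU]
    exact Finset.subset_biUnion_of_mem id hJ
  obtain ⟨j, rfl⟩ := Finset.card_eq_one.1 (hmin J (hCB J hJ) hJI)
  obtain rfl : i = j := by simpa using hiJ
  exact hCX _ hJ

/-- A union of singletons of `I` that lies in `B` is itself a singleton by minimality, so it cannot
come from two distinct ones. -/
theorem singletonFace_mem_extendedNestedComplex (hB : IsBuildingSet B)
    (hmin : ∀ J ∈ B, J ⊆ I → J.card = 1) :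
    singletonFace I ∈ (extendedNestedComplex B).faces := by
  refine ⟨?_, ?_, ?_, ?_⟩
  · intro J hJ
    obtain ⟨i, -, rfl⟩ := inl_mem_singletonFace.1 hJ
    exact hB.singleton_mem i
  · intro J K hJ hK
    obtain ⟨i, -, rfl⟩ := inl_mem_singletonFace.1 hJ
    by_cases h : i ∈ K
    · exact Or.inl (by simpa using h)
    · exact Or.inr (Or.inr (Finset.singleton_inter_of_notMem h))
  · intro C hC hCF hd hU
    have hCI : C.biUnion id ⊆ I := by
      refine Finset.biUnion_subset.2 fun J hJ => ?_
      obtain ⟨i, hi, rfl⟩ := inl_mem_singletonFace.1 (hCF J hJ)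
      simpa using hi
    obtain ⟨a, ha⟩ := Finset.card_eq_one.1 (hmin _ hU hCI)
    obtain ⟨J, hJ, K, hK, hne⟩ := Finset.one_lt_card.1 hC
    have hsing : ∀ J ∈ C, J = {a} := by
      intro J hJ
      obtain ⟨i, -, rfl⟩ := inl_mem_singletonFace.1 (hCF J hJ)
      have : i ∈ C.biUnion id := Finset.mem_biUnion.2 ⟨{i}, hJ, by simp⟩
      rw [ha, Finset.mem_singleton] at this
      rw [this]
    exact hne ((hsing J hJ).trans (hsing K hK).symm)
  · intro i J hi
    exact absurd hi inr_notMem_singletonFace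

/-- Adjoining to a building set `B` a set `I` that contains no non-singleton of `B` amounts to a
stellar subdivision of the extended nested complex. -/
theorem stellarSubdivision_extendedNestedComplex (hB : IsBuildingSet B)
    (hB' : IsBuildingSet (insert I B)) (hI : I ∉ B) (hcard : 2 ≤ I.card)
    (hmin : ∀ J ∈ B, J ⊆ I → J.card = 1) :
    (extendedNestedComplex B).stellarSubdivision (singletonFace I) (Sum.inl I) =
      extendedNestedComplex (insert I B) := by
  have hv : (Sum.inl I : Label (Fin n)) ∉ (extendedNestedComplex B).vertices := fun h =>
    hI (IsExtendedNested.mem h I (Finset.mem_singleton_self _))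
  ext X
  rw [FaceComplex.mem_stellarSubdivision_iff (singletonFace_mem_extendedNestedComplex hB hmin) hv]
  change _ ∧ ((_ ∧ IsExtendedNested B X) ∨ (_ ∧ IsExtendedNested B _)) ↔
    IsExtendedNested (insert I B) X
  constructor
  · rintro ⟨hFX, ⟨hIX, hX⟩ | ⟨hIX, hX⟩⟩
    · refine ⟨fun J hJ => Finset.mem_insert_of_mem (hX.mem J hJ), hX.nested_or_disjoint, ?_,
        hX.design⟩
      intro C hC hCX hd hU
      -- The only union newly forbidden is `I` itself, and members of `B` that cover `I` must be all
      -- of its singletons.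
      rcases Finset.mem_insert.1 hU with hU | hU
      · exact hFX (singletonFace_subset_of_biUnion_eq hmin hCX (fun J hJ => hX.mem J (hCX J hJ)) hU)
      · exact hX.union_not_mem C hC hCX hd hU
    · have hmem : ∀ J, Sum.inl J ∈ X → J ≠ I →
          Sum.inl J ∈ singletonFace I ∪ X.erase (Sum.inl I) := fun J hJ hne => by
        refine Finset.mem_union_right _ (Finset.mem_erase.2 ⟨?_, hJ⟩)
        simpa using hne
      have hsing : ∀ i ∈ I, (Sum.inl {i} : Label (Fin n)) ∈
          singletonFace I ∪ X.erase (Sum.inl I) := fun i hi =>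
        Finset.mem_union_left _ (by simpa using hi)
      have hmemB : ∀ J, Sum.inl J ∈ X → J ≠ I → J ∈ B := fun J hJ hne => hX.mem J (hmem J hJ hne)
      -- If `J` crossed `I`, then `I ∪ J` would lie in `B`, yet it is the disjoint union of `J` and
      -- the singletons of `I \ J`, all of them in one nested collection.
      have hcomp : ∀ J, Sum.inl J ∈ X → I ⊆ J ∨ J ⊆ I ∨ I ∩ J = ∅ := by
        intro J hJ
        by_contra! hcon
        obtain ⟨h1, h2, h3⟩ := hcon
        have hne : J ≠ I := fun h => h2 h.subset
        have hUB : I ∪ J ∈ B := by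
          refine Finset.mem_of_mem_insert_of_ne (hB'.union_mem I (Finset.mem_insert_self _ _) J
            (Finset.mem_insert_of_mem (hmemB J hJ hne)) h3) ?_
          exact fun h => h2 (Finset.union_eq_left.1 h)
        obtain ⟨i, hiI, hiJ⟩ := Finset.not_subset.1 h1
        have hJimg : J ∉ (I \ J).image fun i => ({i} : Finset (Fin n)) := by
          intro h
          obtain ⟨j, hj, rfl⟩ := Finset.mem_image.1 h
          simp at hj
        refine hX.union_not_mem (insert J ((I \ J).image fun i => {i})) ?_ ?_ ?_ ?_
        · rw [Finset.card_insert_of_notMem hJimg, card_image_singleton]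
          have : 0 < (I \ J).card := Finset.card_pos.2 ⟨i, by simp [hiI, hiJ]⟩
          omega
        · intro K hK
          rcases Finset.mem_insert.1 hK with rfl | hK
          · exact hmem _ hJ hne
          · obtain ⟨j, hj, rfl⟩ := Finset.mem_image.1 hK
            exact hsing j (Finset.mem_sdiff.1 hj).1
        · intro K hK K' hK' hKK'
          rcases Finset.mem_insert.1 hK with rfl | hK <;>
            rcases Finset.mem_insert.1 hK' with rfl | hK'
          · exact absurd rfl hKK'
          · obtain ⟨j, hj, rfl⟩ := Finset.mem_image.1 hK'
            exact Finset.inter_singleton_of_notMem (Finset.mem_sdiff.1 hj).2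
          · obtain ⟨j, hj, rfl⟩ := Finset.mem_image.1 hK
            exact Finset.singleton_inter_of_notMem (Finset.mem_sdiff.1 hj).2
          · obtain ⟨j, hj, rfl⟩ := Finset.mem_image.1 hK
            obtain ⟨j', hj', rfl⟩ := Finset.mem_image.1 hK'
            refine Finset.singleton_inter_of_notMem fun h => hKK' ?_
            rw [Finset.mem_singleton.1 h]
        · rwa [Finset.biUnion_insert, biUnion_image_singleton, id, Finset.union_sdiff_self_eq_union,
            Finset.union_comm]
      refine ⟨?_, ?_, ?_, ?_⟩
      · intro J hJ
        by_cases hne : J = I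
        · exact hne ▸ Finset.mem_insert_self _ _
        · exact Finset.mem_insert_of_mem (hmemB J hJ hne)
      · intro J K hJ hK
        by_cases hJI : J = I
        · subst hJI
          exact hcomp K hK
        · by_cases hKI : K = I
          · subst hKI
            rw [Finset.inter_comm]
            have := hcomp J hJ
            tauto
          · exact hX.nested_or_disjoint J K (hmem J hJ hJI) (hmem K hK hKI)
      · intro C hC hCX hd hU
        by_cases hIC : I ∈ C
        · have hdI : ∀ J ∈ C, J ≠ I → I ∩ J = ∅ := fun J hJ hne => hd I hIC J hJ hne.symm
          obtain ⟨J, hJ, hJI⟩ := Finset.exists_mem_ne hC I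
          have hJne : J.Nonempty := hB.nonempty J (hmemB J (hCX J hJ) hJI)
          rcases Finset.mem_insert.1 hU with hU | hU
          · have hJsub : J ⊆ I := by
              rw [← hU]
              exact Finset.subset_biUnion_of_mem id hJ
            have := hdI J hJ hJI
            rw [Finset.inter_eq_right.2 hJsub] at this
            exact hJne.ne_empty this
          -- Replacing `I` by its singletons changes neither the union nor disjointness, and brings
          -- the collection back to `B`.
          · refine hX.union_not_mem (C.erase I ∪ I.image fun i => {i}) ?_ ?_ ?_ ?_
            · exact (hcard.trans_eq (card_image_singleton I).symm).trans
                (Finset.card_le_card Finset.subset_union_right)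
            · intro K hK
              rcases Finset.mem_union.1 hK with hK | hK
              · exact hmem K (hCX K (Finset.mem_of_mem_erase hK)) (Finset.ne_of_mem_erase hK)
              · obtain ⟨j, hj, rfl⟩ := Finset.mem_image.1 hK
                exact hsing j hj
            · have hdis : ∀ K ∈ C.erase I, ∀ i ∈ I, i ∉ K := by
                intro K hK i hi hiK
                have : i ∈ I ∩ K := Finset.mem_inter.2 ⟨hi, hiK⟩
                rw [hdI K (Finset.mem_of_mem_erase hK) (Finset.ne_of_mem_erase hK)] at this
                simp at this
              intro K hK K' hK' hKK'
              rcases Finset.mem_union.1 hK with hK | hK <;>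
                rcases Finset.mem_union.1 hK' with hK' | hK'
              · exact hd K (Finset.mem_of_mem_erase hK) K' (Finset.mem_of_mem_erase hK') hKK'
              · obtain ⟨j, hj, rfl⟩ := Finset.mem_image.1 hK'
                exact Finset.inter_singleton_of_notMem (hdis K hK j hj)
              · obtain ⟨j, hj, rfl⟩ := Finset.mem_image.1 hK
                exact Finset.singleton_inter_of_notMem (hdis K' hK' j hj)
              · obtain ⟨j, hj, rfl⟩ := Finset.mem_image.1 hK
                obtain ⟨j', hj', rfl⟩ := Finset.mem_image.1 hK'
                refine Finset.singleton_inter_of_notMem fun h => hKK' ?_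
                rw [Finset.mem_singleton.1 h]
            · rw [← Finset.insert_erase hIC, Finset.biUnion_insert] at hU
              rwa [Finset.union_biUnion, biUnion_image_singleton, Finset.union_comm]
        · have hne : ∀ J ∈ C, J ≠ I := fun J hJ h => hIC (h ▸ hJ)
          rcases Finset.mem_insert.1 hU with hU | hU
          · exact hFX (singletonFace_subset_of_biUnion_eq hmin hCX
              (fun J hJ => hmemB J (hCX J hJ) (hne J hJ)) hU)
          · exact hX.union_not_mem C hC (fun J hJ => hmem J (hCX J hJ) (hne J hJ)) hd hU
      · intro i J hi hJ hiJ
        have hi' : Sum.inr i ∈ singletonFace I ∪ X.erase (Sum.inl I) :=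
          Finset.mem_union_right _ (Finset.mem_erase.2 ⟨by simp, hi⟩)
        by_cases hne : J = I
        · subst hne
          exact hX.design i {i} hi' (hsing i hiJ) (by simp)
        · exact hX.design i J hi' (hmem J hJ hne) hiJ
  · intro hX
    have hFX := hX.not_singletonFace_subset (Finset.mem_insert_self I B) hcard
    refine ⟨hFX, ?_⟩
    by_cases hIX : Sum.inl I ∈ X
    · refine Or.inr ⟨hIX, ?_⟩
      have hcases : ∀ J, Sum.inl J ∈ singletonFace I ∪ X.erase (Sum.inl I) →
          (∃ i ∈ I, {i} = J) ∨ (J ≠ I ∧ Sum.inl J ∈ X) := by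
        intro J hJ
        rcases Finset.mem_union.1 hJ with hJ | hJ
        · exact Or.inl (inl_mem_singletonFace.1 hJ)
        · refine Or.inr ⟨?_, Finset.mem_of_mem_erase hJ⟩
          simpa using Finset.ne_of_mem_erase hJ
      have hmemB : ∀ J, Sum.inl J ∈ singletonFace I ∪ X.erase (Sum.inl I) → J ∈ B := by
        intro J hJ
        rcases hcases J hJ with ⟨i, -, rfl⟩ | ⟨hne, hJ⟩
        · exact hB.singleton_mem i
        · exact Finset.mem_of_mem_insert_of_ne (hX.mem J hJ) hne
      refine ⟨hmemB, ?_, ?_, ?_⟩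
      · intro J K hJ hK
        rcases hcases J hJ with ⟨i, -, rfl⟩ | ⟨-, hJ'⟩
        · by_cases h : i ∈ K
          · exact Or.inl (by simpa using h)
          · exact Or.inr (Or.inr (Finset.singleton_inter_of_notMem h))
        · rcases hcases K hK with ⟨i, -, rfl⟩ | ⟨-, hK'⟩
          · by_cases h : i ∈ J
            · exact Or.inr (Or.inl (by simpa using h))
            · exact Or.inr (Or.inr (Finset.inter_singleton_of_notMem h))
          · exact hX.nested_or_disjoint J K hJ' hK'
      · intro C hC hCF hd hU
        -- If `C` uses a singleton `{i}` of `I`, each member of `C` is disjoint from `I` or inside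
        -- it: a member containing `I` would meet `{i}`. The members disjoint from `I` form `D`.
        by_cases hmeet : ∃ i ∈ I, {i} ∈ C
        · obtain ⟨i, hiI, hiC⟩ := hmeet
          set D := C.filter fun J => I ∩ J = ∅ with hD
          have hsplit : ∀ J ∈ C, J ∈ D ∨ J ⊆ I := by
            intro J hJ
            rcases hcases J (hCF J hJ) with ⟨j, hj, rfl⟩ | ⟨hne, hJX⟩
            · exact Or.inr (by simpa using hj)
            · rcases hX.nested_or_disjoint I J hIX hJX with h | h | h
              · have hiJ : i ∈ J := h hiI
                by_cases hJi : J = {i}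
                · exact Or.inr (by simpa [hJi] using hiI)
                · have := hd J hJ {i} hiC hJi
                  rw [Finset.inter_singleton_of_mem hiJ] at this
                  simp at this
              · exact Or.inr h
              · exact Or.inl (Finset.mem_filter.2 ⟨hJ, h⟩)
          have hID : I ∉ D := fun h => by
            have := (Finset.mem_filter.1 h).2
            rw [Finset.inter_self] at this
            simp [this] at hiI
          -- If `D` is nonempty, `I` and `D` are disjoint members of `X` whose union `I ∪ ⋃ C` is in
          -- the larger building set, since `I` and `⋃ C` share `i`. If `D` is empty, `⋃ C ⊆ I` is a
          -- singleton, too small for two disjoint nonempty sets.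
          by_cases hDne : D.Nonempty
          · refine hX.union_not_mem (insert I D) ?_ ?_ ?_ ?_
            · rw [Finset.card_insert_of_notMem hID]
              have := hDne.card_pos
              omega
            · intro J hJ
              rcases Finset.mem_insert.1 hJ with rfl | hJ
              · exact hIX
              · obtain ⟨hJC, hdis⟩ := Finset.mem_filter.1 hJ
                rcases hcases J (hCF J hJC) with ⟨j, hj, rfl⟩ | ⟨-, hJX⟩
                · rw [Finset.inter_singleton_of_mem hj] at hdis
                  simp at hdis
                · exact hJX
            · intro J hJ K hK hne
              rcases Finset.mem_insert.1 hJ with rfl | hJ <;>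
                rcases Finset.mem_insert.1 hK with rfl | hK
              · exact absurd rfl hne
              · exact (Finset.mem_filter.1 hK).2
              · rw [Finset.inter_comm]
                exact (Finset.mem_filter.1 hJ).2
              · exact hd J (Finset.mem_filter.1 hJ).1 K (Finset.mem_filter.1 hK).1 hne
            · have hUI : (insert I D).biUnion id = I ∪ C.biUnion id := by
                ext a
                simp only [Finset.biUnion_insert, id, Finset.mem_union, Finset.mem_biUnion]
                constructor
                · rintro (h | ⟨J, hJ, ha⟩)
                  · exact Or.inl h
                  · exact Or.inr ⟨J, (Finset.mem_filter.1 hJ).1, ha⟩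
                · rintro (h | ⟨J, hJ, ha⟩)
                  · exact Or.inl h
                  · rcases hsplit J hJ with h | h
                    · exact Or.inr ⟨J, h, ha⟩
                    · exact Or.inl (h ha)
              rw [hUI]
              refine hB'.union_mem I (Finset.mem_insert_self _ _) _ (Finset.mem_insert_of_mem hU)
                ⟨i, Finset.mem_inter.2 ⟨hiI, Finset.mem_biUnion.2 ⟨{i}, hiC, by simp⟩⟩⟩
          · have hUI : C.biUnion id ⊆ I := by
              refine Finset.biUnion_subset.2 fun J hJ => ?_
              rcases hsplit J hJ with h | h
              · exact absurd ⟨J, h⟩ hDne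
              · exact h
            obtain ⟨a, ha⟩ := Finset.card_eq_one.1 (hmin _ hU hUI)
            obtain ⟨J, hJ, hJi⟩ := Finset.exists_mem_ne hC {i}
            have hia : i ∈ C.biUnion id := Finset.mem_biUnion.2 ⟨{i}, hiC, by simp⟩
            obtain ⟨j, hj⟩ := hB.nonempty J (hmemB J (hCF J hJ))
            have hja : j ∈ C.biUnion id := Finset.mem_biUnion.2 ⟨J, hJ, hj⟩
            rw [ha, Finset.mem_singleton] at hia hja
            have hij : i ∈ J := by rw [hia, ← hja]; exact hj
            have := hd J hJ {i} hiC hJi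
            rw [Finset.inter_singleton_of_mem hij] at this
            simp at this
        · refine hX.union_not_mem C hC ?_ hd (Finset.mem_insert_of_mem hU)
          intro J hJ
          rcases hcases J (hCF J hJ) with ⟨j, hj, rfl⟩ | ⟨-, hJX⟩
          · exact absurd ⟨j, hj, hJ⟩ hmeet
          · exact hJX
      · intro i J hi hJ hiJ
        have hiX : Sum.inr i ∈ X := by
          rcases Finset.mem_union.1 hi with h | h
          · exact absurd h inr_notMem_singletonFace
          · exact Finset.mem_of_mem_erase h
        rcases hcases J hJ with ⟨j, hj, rfl⟩ | ⟨-, hJX⟩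
        · obtain rfl : i = j := by simpa using hiJ
          exact hX.design i I hiX hIX hj
        · exact hX.design i J hiX hJX hiJ
    · refine Or.inl ⟨hIX, ?_, hX.nested_or_disjoint, ?_, hX.design⟩
      · exact fun J hJ => Finset.mem_of_mem_insert_of_ne (hX.mem J hJ) fun h => hIX (h ▸ hJ)
      · exact fun C hC hCX hd hU => hX.union_not_mem C hC hCX hd (Finset.mem_insert_of_mem hU)

/-! ### Initial segments of a decreasing order -/

/-- The collection consisting of all singletons and the members of `L`. -/
def withSingletons (L : List (Finset (Fin n))) : Finset (Finset (Fin n)) :=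
  Finset.univ.image (fun i => {i}) ∪ L.toFinset

theorem mem_withSingletons {L : List (Finset (Fin n))} {J : Finset (Fin n)} :
    J ∈ withSingletons L ↔ J.card = 1 ∨ J ∈ L := by
  simp [withSingletons, Finset.card_eq_one, eq_comm]

theorem withSingletons_concat (L : List (Finset (Fin n))) (I : Finset (Fin n)) :
    withSingletons (L ++ [I]) = insert I (withSingletons L) := by
  ext J
  simp only [mem_withSingletons, List.mem_append, List.mem_singleton, Finset.mem_insert]
  tauto

theorem extendedNestedComplex_withSingletons_nil :
    extendedNestedComplex (withSingletons []) = crossComplex n := by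
  ext X
  change IsExtendedNested _ X ↔ _ ∧ _
  constructor
  · intro hX
    refine ⟨fun I hI => ?_, fun i hi => hX.design i {i} hi.2 hi.1 (by simp)⟩
    simpa [mem_withSingletons, Finset.card_eq_one] using hX.mem I hI
  · rintro ⟨hX, hd⟩
    refine ⟨?_, ?_, ?_, ?_⟩
    · intro J hJ
      obtain ⟨i, rfl⟩ := hX J hJ
      simp [mem_withSingletons]
    · intro J K hJ hK
      obtain ⟨i, rfl⟩ := hX J hJ
      by_cases h : i ∈ K
      · exact Or.inl (by simpa using h)
      · exact Or.inr (Or.inr (Finset.singleton_inter_of_notMem h))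
    · intro C hC hCX _ hU
      obtain ⟨a, ha⟩ : ∃ a, C.biUnion id = {a} := by
        simpa [mem_withSingletons, Finset.card_eq_one] using hU
      have hsing : ∀ J ∈ C, J = {a} := by
        intro J hJ
        obtain ⟨i, rfl⟩ := hX J (hCX J hJ)
        have : i ∈ C.biUnion id := Finset.mem_biUnion.2 ⟨{i}, hJ, by simp⟩
        rw [ha, Finset.mem_singleton] at this
        rw [this]
      obtain ⟨J, hJ, K, hK, hne⟩ := Finset.one_lt_card.1 hC
      exact hne ((hsing J hJ).trans (hsing K hK).symm)
    · intro i J hi hJ hiJ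
      obtain ⟨j, rfl⟩ := hX J hJ
      obtain rfl : i = j := by simpa using hiJ
      exact hd i ⟨hJ, hi⟩

variable {L L' : List (Finset (Fin n))}

/-- If two meeting members are incomparable, their union is strictly larger than either, so the
decreasing order has already listed it. Comparable members have nothing to prove, and a singleton is
comparable with whatever it meets. -/
theorem IsDecreasingOrder.isBuildingSet_prefix (hB : IsBuildingSet B) (hL : IsDecreasingOrder B L)
    (h : L' <+: L) : IsBuildingSet (withSingletons L') := by
  obtain ⟨M, rfl⟩ := h
  have hmemB : ∀ J ∈ withSingletons L', J ∈ B := by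
    intro J hJ
    rcases mem_withSingletons.1 hJ with h | h
    · obtain ⟨i, rfl⟩ := Finset.card_eq_one.1 h
      exact hB.singleton_mem i
    · exact ((hL.mem_iff J).1 (List.mem_append_left M h)).1
  have hpair := (List.pairwise_append.1 hL.decreasing).2.2
  refine ⟨fun J hJ => hB.nonempty J (hmemB J hJ), fun i => by simp [mem_withSingletons], ?_⟩
  intro J hJ K hK hne
  by_cases hJK : J ⊆ K
  · rwa [Finset.union_eq_right.2 hJK]
  by_cases hKJ : K ⊆ J
  · rwa [Finset.union_eq_left.2 hKJ]
  rcases mem_withSingletons.1 hJ with hJ1 | hJL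
  · obtain ⟨i, rfl⟩ := Finset.card_eq_one.1 hJ1
    obtain ⟨j, hj⟩ := hne
    simp only [Finset.mem_inter, Finset.mem_singleton] at hj
    exact absurd (by simpa [← hj.1] using hj.2) hJK
  · have hlt : J.card < (J ∪ K).card := Finset.card_lt_card
      (Finset.ssubset_iff_subset_ne.2 ⟨Finset.subset_union_left, fun h => hKJ (by
        rw [h]
        exact Finset.subset_union_right)⟩)
    have hpos : 0 < J.card := (hB.nonempty J (hmemB J hJ)).card_pos
    have hU : J ∪ K ∈ L' ++ M := (hL.mem_iff _).2
      ⟨hB.union_mem J (hmemB J hJ) K (hmemB K hK) hne, by omega⟩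
    rcases List.mem_append.1 hU with hU | hU
    · exact mem_withSingletons.2 (Or.inr hU)
    · exact absurd (hpair J hJL _ hU) (by omega)

theorem IsDecreasingOrder.withSingletons_eq (hB : IsBuildingSet B) (hL : IsDecreasingOrder B L) :
    withSingletons L = B := by
  ext J
  rw [mem_withSingletons, hL.mem_iff]
  constructor
  · rintro (h | h)
    · obtain ⟨i, rfl⟩ := Finset.card_eq_one.1 h
      exact hB.singleton_mem i
    · exact h.1
  · tauto

/-- The hypotheses under which the next member of a decreasing order is adjoined. -/
theorem IsDecreasingOrder.next (hB : IsBuildingSet B) (hL : IsDecreasingOrder B L)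
    (h : L' ++ [I] <+: L) :
    I ∉ withSingletons L' ∧ 2 ≤ I.card ∧ ∀ J ∈ withSingletons L', J ⊆ I → J.card = 1 := by
  have hIL : I ∈ L := h.subset (by simp)
  obtain ⟨hIB, hI1⟩ := (hL.mem_iff I).1 hIL
  have hpos := (hB.nonempty I hIB).card_pos
  have hIL' : I ∉ L' := fun hmem => by
    have := hL.nodup.sublist h.sublist
    simp only [List.nodup_append, List.mem_singleton] at this
    exact this.2.2 I hmem I rfl rfl
  have hnot : I ∉ withSingletons L' := by
    rw [mem_withSingletons]
    tauto
  refine ⟨hnot, by omega, fun J hJ hJI => ?_⟩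
  rcases mem_withSingletons.1 hJ with h1 | h1
  · exact h1
  -- Earlier members are at least as large as `I`, so one contained in `I` equals `I`, against the
  -- absence of repetitions.
  · have hp := (List.pairwise_append.1 (hL.decreasing.sublist h.sublist)).2.2 J h1 I (by simp)
    exact absurd (Finset.eq_of_subset_of_card_le hJI hp ▸ h1) hIL'

theorem iteratedSubdivision_concat (L : List (Finset (Fin n))) (I : Finset (Fin n)) :
    iteratedSubdivision (L ++ [I]) =
      (iteratedSubdivision L).stellarSubdivision (singletonFace I) (Sum.inl I) := by
  simp [iteratedSubdivision]

theorem IsDecreasingOrder.iteratedSubdivision_prefix (hB : IsBuildingSet B)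
    (hL : IsDecreasingOrder B L) (h : L' <+: L) :
    iteratedSubdivision L' = extendedNestedComplex (withSingletons L') := by
  induction L' using List.reverseRecOn with
  | nil => exact extendedNestedComplex_withSingletons_nil.symm
  | append_singleton L' I ih =>
    have h' : L' <+: L := (List.prefix_append L' [I]).trans h
    obtain ⟨h1, h2, h3⟩ := hL.next hB h
    have hb := hL.isBuildingSet_prefix hB h
    rw [withSingletons_concat] at hb
    rw [iteratedSubdivision_concat, ih h', withSingletons_concat,
      stellarSubdivision_extendedNestedComplex (hL.isBuildingSet_prefix hB h') hb h1 h2 h3]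

end ExtNested

/-! ### Polar duality for labelled point configurations -/

namespace ExtNested

open Filter Topology

/-- Where a functional attains on a convex hull a bound valid on the generators. -/
theorem mem_convexHull_of_eq_one {E : Type*} [AddCommGroup E] [Module ℝ E] [TopologicalSpace E]
    {S : Set E} {l : StrongDual ℝ E} (hl : ∀ y ∈ S, l y ≤ 1) {x : E} (hx : x ∈ convexHull ℝ S) :
    l x ≤ 1 ∧ (l x = 1 → x ∈ convexHull ℝ {y ∈ S | l y = 1}) := by
  have hconv : Convex ℝ {x | l x ≤ 1 ∧ (l x = 1 → x ∈ convexHull ℝ {y ∈ S | l y = 1})} := by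
    rw [convex_iff_forall_pos]
    rintro x ⟨hx1, hx2⟩ y ⟨hy1, hy2⟩ a b ha hb hab
    have hval : l (a • x + b • y) = a * l x + b * l y := by simp
    refine ⟨by rw [hval]; nlinarith, fun h => ?_⟩
    rw [hval] at h
    have h1 : l x = 1 := by nlinarith
    have h2 : l y = 1 := by nlinarith
    exact convex_convexHull ℝ _ (hx2 h1) (hy2 h2) ha.le hb.le hab
  have hsub : S ⊆ {x | l x ≤ 1 ∧ (l x = 1 → x ∈ convexHull ℝ {y ∈ S | l y = 1})} :=
    fun y hy => ⟨hl y hy, fun h => subset_convexHull ℝ _ ⟨hy, h⟩⟩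
  exact convexHull_min hsub hconv hx

namespace LabelledPoints

variable {V : Type} {n : ℕ} {P : LabelledPoints V n}
  {l m : StrongDual ℝ (Fin n → ℝ)}

/-- The polar dual of the polytope. -/
def dualBody (P : LabelledPoints V n) : Set (StrongDual ℝ (Fin n → ℝ)) :=
  {l | ∀ v ∈ P.labels, l (P.point v) ≤ 1}

open Classical in
/-- The labels of the points on the hyperplane `l = 1`. -/
noncomputable def active (P : LabelledPoints V n) (l : StrongDual ℝ (Fin n → ℝ)) : Finset V :=
  P.labels.filter fun v => l (P.point v) = 1

theorem mem_active {v : V} : v ∈ P.active l ↔ v ∈ P.labels ∧ l (P.point v) = 1 := by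
  simp [active]

theorem active_subset : P.active l ⊆ P.labels := fun _ hv => (mem_active.1 hv).1

theorem point_mem_hull {σ : Finset V} {v : V} (hv : v ∈ σ) : P.point v ∈ P.hull σ :=
  subset_convexHull ℝ _ ⟨v, hv, rfl⟩

/-- The members of the dual body that correspond to facets. -/
structure IsFacetNormal (P : LabelledPoints V n) (m : StrongDual ℝ (Fin n → ℝ)) : Prop where
  mem : m ∈ P.dualBody
  span_eq_top : Submodule.span ℝ (P.point '' (P.active m : Set V)) = ⊤

theorem le_one_of_mem_polytope (hl : l ∈ P.dualBody) {x : Fin n → ℝ} (hx : x ∈ P.polytope) :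
    l x ≤ 1 := by
  refine (mem_convexHull_of_eq_one ?_ hx).1
  rintro _ ⟨v, hv, rfl⟩
  exact hl v hv

theorem eq_one_of_mem_hull_active {x : Fin n → ℝ} (hx : x ∈ P.hull (P.active l)) : l x = 1 := by
  have hconv : Convex ℝ {x | l x = 1} := convex_hyperplane l.isLinear 1
  refine convexHull_min ?_ hconv hx
  rintro _ ⟨v, hv, rfl⟩
  exact (mem_active.1 hv).2

theorem hull_active (hl : l ∈ P.dualBody) : P.hull (P.active l) = {x ∈ P.polytope | l x = 1} := by
  ext x
  constructor
  · exact fun hx => ⟨convexHull_mono (Set.image_mono (by exact_mod_cast active_subset)) hx,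
      eq_one_of_mem_hull_active hx⟩
  · rintro ⟨hx, h1⟩
    have hS : ∀ y ∈ P.point '' (P.labels : Set V), l y ≤ 1 := by
      rintro _ ⟨v, hv, rfl⟩
      exact hl v hv
    refine convexHull_mono ?_ ((mem_convexHull_of_eq_one hS hx).2 h1)
    rintro _ ⟨⟨v, hv, rfl⟩, h⟩
    exact ⟨v, mem_active.2 ⟨hv, h⟩, rfl⟩

theorem hull_subset_hull_active_iff {σ : Finset V} (hσ : σ ⊆ P.labels) :
    P.hull σ ⊆ P.hull (P.active l) ↔ σ ⊆ P.active l := by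
  refine ⟨fun h v hv => mem_active.2 ⟨hσ hv, eq_one_of_mem_hull_active (h (point_mem_hull hv))⟩,
    fun h => convexHull_mono (Set.image_mono (by exact_mod_cast h))⟩

theorem convex_dualBody : Convex ℝ P.dualBody := by
  intro l hl m hm a b ha hb hab v hv
  have h1 := hl v hv
  have h2 := hm v hv
  change a * l (P.point v) + b * m (P.point v) ≤ 1
  nlinarith

/-- A weighted mean of two numbers at most 1, with both weights positive, is 1 only if both are 1.
This turns convex combinations in the dual into intersections of faces. -/
theorem active_combo [DecidableEq V] (hl : l ∈ P.dualBody) (hm : m ∈ P.dualBody) {a b : ℝ} (ha : 0 < a)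
    (hb : 0 < b) (hab : a + b = 1) : P.active (a • l + b • m) = P.active l ∩ P.active m := by
  ext v
  rw [Finset.mem_inter, mem_active, mem_active, mem_active]
  change _ ∧ a * l (P.point v) + b * m (P.point v) = 1 ↔ _
  constructor
  · rintro ⟨hv, h⟩
    have h1 := hl v hv
    have h2 := hm v hv
    exact ⟨⟨hv, by nlinarith⟩, hv, by nlinarith⟩
  · rintro ⟨⟨hv, h1⟩, -, h2⟩
    exact ⟨hv, by rw [h1, h2]; linarith⟩

theorem IsFacetNormal.ext_active (hl : P.IsFacetNormal l) (h : P.active l = P.active m) :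
    l = m := by
  have : (l : (Fin n → ℝ) →ₗ[ℝ] ℝ) = m := by
    refine LinearMap.ext_on hl.span_eq_top ?_
    rintro _ ⟨v, hv, rfl⟩
    have hv' : v ∈ P.active m := h ▸ hv
    exact (mem_active.1 hv).2.trans (mem_active.1 hv').2.symm
  exact ContinuousLinearMap.coe_injective this

theorem finite_facetNormals (P : LabelledPoints V n) : {m | P.IsFacetNormal m}.Finite := by
  refine Set.Finite.of_injOn (f := P.active) (t := P.labels.powerset) ?_ ?_
    (Finset.finite_toSet _)
  · intro m _
    simpa using active_subset
  · intro l hl m _ h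
    exact IsFacetNormal.ext_active hl h

theorem isCompact_dualBody (h0 : (0 : Fin n → ℝ) ∈ interior P.polytope) :
    IsCompact P.dualBody := by
  refine Metric.isCompact_of_isClosed_isBounded ?_ ?_
  · have : P.dualBody = ⋂ v ∈ P.labels, {l | l (P.point v) ≤ 1} := by
      ext l
      simp [dualBody]
    rw [this]
    refine isClosed_biInter fun v _ => isClosed_le ?_ continuous_const
    exact (ContinuousLinearMap.apply ℝ ℝ (P.point v)).continuous
  · obtain ⟨r, hr, hball⟩ := Metric.nhds_basis_closedBall.mem_iff.1 (mem_interior_iff_mem_nhds.1 h0)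
    refine (Metric.isBounded_closedBall (x := 0) (r := 1 / r)).subset fun l hl => ?_
    rw [mem_closedBall_zero_iff]
    refine ContinuousLinearMap.opNorm_bound_of_ball_bound hr 1 l fun z hz => ?_
    rw [Real.norm_eq_abs, abs_le]
    have h1 := le_one_of_mem_polytope hl (hball hz)
    have h2 := le_one_of_mem_polytope hl (hball (a := -z) (by simpa using hz))
    rw [map_neg] at h2
    exact ⟨by linarith, h1⟩

/-- If the active points do not span, a nonzero functional `g` kills them. The inactive inequalities
are strict, so `l ± ε • g` stays in the dual body for small `ε`, and `l` is a midpoint. -/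
theorem isFacetNormal_of_mem_extremePoints (h : l ∈ P.dualBody.extremePoints ℝ) :
    P.IsFacetNormal l := by
  rw [mem_extremePoints] at h
  obtain ⟨hl, hext⟩ := h
  refine ⟨hl, ?_⟩
  by_contra hspan
  obtain ⟨f, hf, hker⟩ := Submodule.exists_le_ker_of_lt_top _ (lt_top_iff_ne_top.2 hspan)
  set g : StrongDual ℝ (Fin n → ℝ) := LinearMap.toContinuousLinearMap f with hg
  have hg0 : ∀ v ∈ P.active l, g (P.point v) = 0 := fun v hv =>
    hker (Submodule.subset_span ⟨v, hv, rfl⟩)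
  have hev : ∀ᶠ ε : ℝ in 𝓝 0, ∀ v ∈ P.labels, l (P.point v) + ε * g (P.point v) ≤ 1 := by
    rw [Filter.eventually_all_finset]
    intro v hv
    by_cases hva : v ∈ P.active l
    · exact Eventually.of_forall fun ε => by
        rw [hg0 v hva, mul_zero, add_zero]
        exact hl v hv
    · have hlt : l (P.point v) < 1 := lt_of_le_of_ne (hl v hv) fun h => hva (mem_active.2 ⟨hv, h⟩)
      have ht : Tendsto (fun ε : ℝ => l (P.point v) + ε * g (P.point v)) (𝓝 0)
          (𝓝 (l (P.point v) + 0 * g (P.point v))) :=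
        (Continuous.tendsto (by fun_prop) 0)
      rw [zero_mul, add_zero] at ht
      exact (ht.eventually_lt_const hlt).mono fun _ h => h.le
  obtain ⟨δ, hδ, hball⟩ := Metric.eventually_nhds_iff.1 hev
  have hmem : ∀ ε : ℝ, |ε| < δ → l + ε • g ∈ P.dualBody := fun ε hε v hv =>
    hball (by simpa using hε) v hv
  have hpos : |δ / 2| < δ := by
    rw [abs_of_pos (by linarith)]
    linarith
  have := (hext _ (hmem (δ / 2) hpos) _ (hmem (-(δ / 2)) (by rwa [abs_neg]))
    ⟨1 / 2, 1 / 2, by norm_num, by norm_num, by norm_num, by module⟩).1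
  rw [add_eq_left, smul_eq_zero] at this
  rcases this with h | h
  · linarith
  · refine hf (LinearMap.ext fun x => ?_)
    exact DFunLike.congr_fun h x

/-- Krein–Milman; no closure is needed because there are finitely many facet normals. -/
theorem dualBody_eq_convexHull (h0 : (0 : Fin n → ℝ) ∈ interior P.polytope) :
    P.dualBody = convexHull ℝ {m | P.IsFacetNormal m} := by
  refine Set.Subset.antisymm ?_ (convexHull_min (fun m hm => hm.mem) convex_dualBody)
  rw [← closure_convexHull_extremePoints (isCompact_dualBody h0) convex_dualBody]
  exact closure_minimal
    (convexHull_mono fun m hm => isFacetNormal_of_mem_extremePoints hm)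
    (P.finite_facetNormals.isClosed_convexHull ℝ)

theorem dualBody_induction (h0 : (0 : Fin n → ℝ) ∈ interior P.polytope)
    {p : StrongDual ℝ (Fin n → ℝ) → Prop} (facet : ∀ m, P.IsFacetNormal m → p m)
    (combo : ∀ l ∈ P.dualBody, ∀ m ∈ P.dualBody, p l → p m → ∀ a b : ℝ, 0 < a → 0 < b →
      a + b = 1 → p (a • l + b • m)) (hl : l ∈ P.dualBody) : p l := by
  have hconv : Convex ℝ {l | l ∈ P.dualBody ∧ p l} := by
    rw [convex_iff_forall_pos]
    rintro l ⟨hl, hpl⟩ m ⟨hm, hpm⟩ a b ha hb hab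
    exact ⟨convex_dualBody hl hm ha.le hb.le hab, combo l hl m hm hpl hpm a b ha hb hab⟩
  rw [dualBody_eq_convexHull h0] at hl
  have hsub : {m | P.IsFacetNormal m} ⊆ {l | l ∈ P.dualBody ∧ p l} :=
    fun m hm => ⟨hm.mem, facet m hm⟩
  exact (convexHull_min hsub hconv hl).2

/-! ### Proper faces and facets -/

theorem isProperFace_hull_active (h0 : (0 : Fin n → ℝ) ∈ interior P.polytope)
    (hl : l ∈ P.dualBody) : IsProperFace P.polytope (P.hull (P.active l)) := by
  refine ⟨?_, fun h => ?_⟩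
  · rintro ⟨x₀, hx₀⟩
    refine ⟨l, ?_⟩
    have h₀ := hx₀
    rw [hull_active hl] at h₀ ⊢
    ext x
    refine ⟨fun hx => ⟨hx.1, fun y hy => ?_⟩, fun hx => ⟨hx.1, le_antisymm ?_ ?_⟩⟩
    · rw [hx.2]
      exact le_one_of_mem_polytope hl hy
    · exact le_one_of_mem_polytope hl hx.1
    · rw [← h₀.2]
      exact hx.2 x₀ h₀.1
  · have h00 := interior_subset h0
    rw [← h] at h00
    have := eq_one_of_mem_hull_active h00
    simp at this

/-- A functional that is nonpositive near the origin vanishes. -/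
theorem eq_zero_of_nonpos {s : Set (Fin n → ℝ)} (h0 : (0 : Fin n → ℝ) ∈ interior s)
    (h : ∀ x ∈ s, l x ≤ 0) : l = 0 := by
  obtain ⟨r, hr, hball⟩ := Metric.nhds_basis_closedBall.mem_iff.1 (mem_interior_iff_mem_nhds.1 h0)
  have := ContinuousLinearMap.opNorm_bound_of_ball_bound hr 0 l fun z hz => by
    have h1 := h z (hball hz)
    have h2 := h (-z) (hball (by simpa using hz))
    rw [map_neg] at h2
    rw [Real.norm_eq_abs, abs_le]
    constructor <;> linarith
  rw [zero_div] at this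
  exact norm_le_zero_iff.1 this

/-- A functional exposing a nonempty proper face has positive maximum on the polytope, since the
origin is interior, and can be scaled to maximum 1. The empty face is the active set of `l = 0`. -/
theorem isProperFace_iff (h0 : (0 : Fin n → ℝ) ∈ interior P.polytope) {F : Set (Fin n → ℝ)} :
    IsProperFace P.polytope F ↔ ∃ l ∈ P.dualBody, F = P.hull (P.active l) := by
  constructor
  · rintro ⟨hexp, hne⟩
    rcases F.eq_empty_or_nonempty with rfl | hF
    · refine ⟨0, fun v _ => by simp, ?_⟩
      have : P.active (0 : StrongDual ℝ (Fin n → ℝ)) = ∅ := by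
        ext v
        simp [mem_active]
      simp [this, hull]
    · obtain ⟨l, hl⟩ := hexp hF
      obtain ⟨x₀, hx₀⟩ := hF
      have hmax : ∀ y ∈ P.polytope, l y ≤ l x₀ := by
        rw [hl] at hx₀
        exact hx₀.2
      have hx₀P : x₀ ∈ P.polytope := by
        rw [hl] at hx₀
        exact hx₀.1
      have hnn : 0 ≤ l x₀ := by simpa using hmax 0 (interior_subset h0)
      have hpos : 0 < l x₀ := by
        refine lt_of_le_of_ne hnn fun h => hne ?_
        have hl0 : l = 0 := eq_zero_of_nonpos h0 (by rw [h]; exact hmax)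
        rw [hl, hl0]
        simp
      have hD : (l x₀)⁻¹ • l ∈ P.dualBody := fun v hv => by
        change (l x₀)⁻¹ * l (P.point v) ≤ 1
        rw [inv_mul_le_one₀ hpos]
        exact hmax _ (point_mem_hull hv)
      refine ⟨_, hD, ?_⟩
      rw [hull_active hD, hl]
      ext x
      change _ ∧ _ ↔ _ ∧ (l x₀)⁻¹ * l x = 1
      rw [inv_mul_eq_one₀ hpos.ne']
      refine and_congr_right fun hx => ⟨fun h => le_antisymm (h x₀ hx₀P) (hmax x hx), fun h => ?_⟩
      rw [← h]
      exact hmax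
  · rintro ⟨l, hl, rfl⟩
    exact isProperFace_hull_active h0 hl

theorem dim_polytope (h0 : (0 : Fin n → ℝ) ∈ interior P.polytope) : dim P.polytope = n := by
  have h : affineSpan ℝ P.polytope = ⊤ := by
    refine affineSpan_eq_top_of_nonempty_interior ⟨0, ?_⟩
    rwa [polytope, hull, (convex_convexHull ℝ _).convexHull_eq]
  rw [dim, ← direction_affineSpan, h, AffineSubspace.direction_top, finrank_top,
    Module.finrank_fin_fun]

theorem span_eq_vectorSpan_sup {E : Type*} [AddCommGroup E] [Module ℝ E] {S : Set E} {x₀ : E}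
    (hx₀ : x₀ ∈ S) : Submodule.span ℝ S = vectorSpan ℝ S ⊔ Submodule.span ℝ {x₀} := by
  refine le_antisymm (Submodule.span_le.2 fun x hx => ?_) (sup_le ?_ ?_)
  · have h1 : x - x₀ ∈ vectorSpan ℝ S := vsub_mem_vectorSpan ℝ hx hx₀
    have h2 := Submodule.add_mem_sup h1 (Submodule.mem_span_singleton_self x₀)
    simpa using h2
  · rw [vectorSpan, Submodule.span_le]
    rintro _ ⟨x, hx, y, hy, rfl⟩
    exact Submodule.sub_mem _ (Submodule.subset_span hx) (Submodule.subset_span hy)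
  · exact Submodule.span_mono (Set.singleton_subset_iff.2 hx₀)

/-- Directions within the face lie in the kernel of `l`, while `l` is 1 on each active point. So the
linear span is the direction space plus one independent line. -/
theorem dim_hull_active {v : V} (hv : v ∈ P.active l) :
    dim (P.hull (P.active l)) + 1 =
      Module.finrank ℝ (Submodule.span ℝ (P.point '' (P.active l : Set V))) := by
  have hx₀ : P.point v ∈ P.point '' (P.active l : Set V) := ⟨v, hv, rfl⟩
  have hl1 := (mem_active.1 hv).2
  have hne : P.point v ≠ 0 := fun h => by simp [h] at hl1
  have hker : vectorSpan ℝ (P.point '' (P.active l : Set V)) ≤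
      (l : (Fin n → ℝ) →ₗ[ℝ] ℝ).ker := by
    rw [vectorSpan, Submodule.span_le]
    rintro _ ⟨_, ⟨u, hu, rfl⟩, _, ⟨w, hw, rfl⟩, rfl⟩
    simp [(mem_active.1 hu).2, (mem_active.1 hw).2]
  have hdisj : vectorSpan ℝ (P.point '' (P.active l : Set V)) ⊓
      Submodule.span ℝ {P.point v} = ⊥ := by
    rw [← disjoint_iff, Submodule.disjoint_span_singleton' hne]
    intro h
    have := hker h
    simp [hl1] at this
  have := Submodule.finrank_sup_add_finrank_inf_eq
    (vectorSpan ℝ (P.point '' (P.active l : Set V))) (Submodule.span ℝ {P.point v})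
  rw [hdisj, finrank_bot, add_zero, finrank_span_singleton hne, ← span_eq_vectorSpan_sup hx₀]
    at this
  rw [this, dim, hull, ← direction_affineSpan, affineSpan_convexHull, direction_affineSpan]

theorem isFacet_iff (hn : 1 ≤ n) (h0 : (0 : Fin n → ℝ) ∈ interior P.polytope)
    {G : Set (Fin n → ℝ)} :
    IsFacet P.polytope G ↔ ∃ m, P.IsFacetNormal m ∧ G = P.hull (P.active m) := by
  constructor
  · rintro ⟨hexp, hG, hdim⟩
    have hne : G ≠ P.polytope := by
      rintro rfl
      omega
    obtain ⟨m, hm, rfl⟩ := (isProperFace_iff h0).1 ⟨hexp, hne⟩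
    obtain ⟨_, v, hv, rfl⟩ := convexHull_nonempty_iff.1 hG
    refine ⟨m, ⟨hm, Submodule.eq_top_of_finrank_eq ?_⟩, rfl⟩
    rw [← dim_hull_active hv, hdim, dim_polytope h0, Module.finrank_fin_fun]
  · rintro ⟨m, hm, rfl⟩
    have hne : (P.active m).Nonempty := by
      by_contra h
      have h' := hm.span_eq_top
      rw [Finset.not_nonempty_iff_eq_empty.1 h, Finset.coe_empty, Set.image_empty,
        Submodule.span_empty] at h'
      have h'' := finrank_top ℝ (Fin n → ℝ)
      rw [← h', finrank_bot, Module.finrank_fin_fun] at h''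
      omega
    obtain ⟨v, hv⟩ := hne
    refine ⟨(isProperFace_hull_active h0 hm.mem).1, ⟨_, point_mem_hull hv⟩, ?_⟩
    rw [dim_hull_active hv, hm.span_eq_top, dim_polytope h0, finrank_top, Module.finrank_fin_fun]

/-- Up to scaling, a facet has only one defining functional. -/
theorem IsFacetNormal.eq_smul (hm : P.IsFacetNormal m) {c : ℝ}
    (h : P.hull (P.active m) = {x ∈ P.polytope | l x = c}) : l = c • m := by
  have : (l : (Fin n → ℝ) →ₗ[ℝ] ℝ) = (c • m : StrongDual ℝ (Fin n → ℝ)) := by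
    refine LinearMap.ext_on hm.span_eq_top ?_
    rintro _ ⟨v, hv, rfl⟩
    have hv' : P.point v ∈ P.hull (P.active m) := point_mem_hull hv
    rw [h] at hv'
    simp [hv'.2, (mem_active.1 hv).2]
  exact ContinuousLinearMap.coe_injective this

/-- Any functional defining the facet at level `c` is `c • m`. Here `c ≥ 0` because the origin is in
the polytope, and `c = 0` cannot separate. -/
theorem isBeyond_iff (h0 : (0 : Fin n → ℝ) ∈ interior P.polytope) (hm : P.IsFacetNormal m)
    {p : Fin n → ℝ} : IsBeyond P.polytope (P.hull (P.active m)) p ↔ 1 < m p := by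
  constructor
  · rintro ⟨l, c, hle, hF, hp⟩
    have hc : 0 ≤ c := by simpa using hle 0 (interior_subset h0)
    rw [hm.eq_smul hF] at hp
    change c < c * m p at hp
    rcases hc.eq_or_lt with rfl | hc
    · simp at hp
    · exact (lt_mul_iff_one_lt_right hc).1 hp
  · exact fun h => ⟨m, 1, fun x hx => le_one_of_mem_polytope hm.mem hx, hull_active hm.mem, h⟩

theorem isBeneath_iff (h0 : (0 : Fin n → ℝ) ∈ interior P.polytope) (hm : P.IsFacetNormal m)
    {p : Fin n → ℝ} : IsBeneath P.polytope (P.hull (P.active m)) p ↔ m p < 1 := by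
  constructor
  · rintro ⟨l, c, hle, hF, hp⟩
    have hc : 0 ≤ c := by simpa using hle 0 (interior_subset h0)
    rw [hm.eq_smul hF] at hp
    change c * m p < c at hp
    rcases hc.eq_or_lt with rfl | hc
    · simp at hp
    · exact (mul_lt_iff_lt_one_right hc).1 hp
  · exact fun h => ⟨m, 1, fun x hx => le_one_of_mem_polytope hm.mem hx, hull_active hm.mem, h⟩

theorem isStellarPoint_iff (hn : 1 ≤ n) (h0 : (0 : Fin n → ℝ) ∈ interior P.polytope)
    {σ : Finset V} (hσ : σ ⊆ P.labels) {p : Fin n → ℝ} :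
    P.IsStellarPoint σ p ↔ IsProperFace P.polytope (P.hull σ) ∧ ∀ m, P.IsFacetNormal m →
      (σ ⊆ P.active m → 1 < m p) ∧ (¬ σ ⊆ P.active m → m p < 1) := by
  refine and_congr_right fun _ => ⟨fun h m hm => ?_, fun h G hG => ?_⟩
  · have := h _ ((isFacet_iff hn h0).2 ⟨m, hm, rfl⟩)
    rwa [isBeyond_iff h0 hm, isBeneath_iff h0 hm, hull_subset_hull_active_iff hσ] at this
  · obtain ⟨m, hm, rfl⟩ := (isFacet_iff hn h0).1 hG
    rw [isBeyond_iff h0 hm, isBeneath_iff h0 hm, hull_subset_hull_active_iff hσ]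
    exact h m hm

end LabelledPoints

end ExtNested

/-! ### Realizing complexes by polytopes through the dual body -/

namespace ExtNested

open Filter Topology

namespace LabelledPoints

variable {V : Type} {n : ℕ} {P : LabelledPoints V n} {Δ : FaceComplex V}
  {l m : StrongDual ℝ (Fin n → ℝ)}

/-- The dual description of the statement that the labels identify `Δ` with the boundary complex of
a simplicial polytope that has the origin in its interior. -/
structure Realizes (P : LabelledPoints V n) (Δ : FaceComplex V) : Prop where
  zero_mem : (0 : Fin n → ℝ) ∈ interior P.polytope
  linearIndepOn : ∀ l ∈ P.dualBody, LinearIndepOn ℝ P.point (P.active l : Set V)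
  mem_faces : ∀ τ : Finset V, τ ∈ Δ.faces ↔ ∃ l ∈ P.dualBody, P.active l = τ
  singleton_mem : ∀ v ∈ P.labels, {v} ∈ Δ.faces

namespace Realizes

theorem subset_labels (h : P.Realizes Δ) {τ : Finset V} (hτ : τ ∈ Δ.faces) : τ ⊆ P.labels := by
  obtain ⟨l, -, rfl⟩ := (h.mem_faces τ).1 hτ
  exact active_subset

theorem vertices_eq (h : P.Realizes Δ) : Δ.vertices = P.labels := by
  ext v
  exact ⟨fun hv => h.subset_labels hv (Finset.mem_singleton_self v), h.singleton_mem v⟩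

theorem isProperFace (h : P.Realizes Δ) {σ : Finset V} (hσ : σ ∈ Δ.faces) :
    IsProperFace P.polytope (P.hull σ) := by
  obtain ⟨l, hl, rfl⟩ := (h.mem_faces σ).1 hσ
  exact isProperFace_hull_active h.zero_mem hl

theorem isGeometricRealization (h : P.Realizes Δ) :
    IsGeometricRealization Δ P.polytope P.point := by
  classical
  refine ⟨⟨⟨P.labels.image P.point, ?_⟩, fun F hF => ?_⟩, ⟨?_, ?_, ?_⟩, fun σ hσ => ?_⟩
  · rw [Finset.coe_image]
    rfl
  · obtain ⟨l, hl, rfl⟩ := (isProperFace_iff h.zero_mem).1 hF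
    refine ⟨(P.active l).image P.point, ?_, by rw [Finset.coe_image]; rfl⟩
    have := (h.linearIndepOn l hl).id_image
    rw [← Finset.coe_image] at this
    exact LinearIndependent.affineIndependent ℝ this
  · intro v hv
    have := (h.isProperFace hv).1.isExtreme
    rw [hull, Finset.coe_singleton, Set.image_singleton, convexHull_singleton] at this
    exact isExtreme_singleton.1 this
  · intro v hv w hw hvw
    obtain ⟨l, -, hl⟩ := (h.mem_faces {v}).1 hv
    have h1 : v ∈ P.active l := hl ▸ Finset.mem_singleton_self v
    rw [h.vertices_eq] at hw
    have h2 : w ∈ P.active l := mem_active.2 ⟨hw, hvw ▸ (mem_active.1 h1).2⟩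
    rw [hl, Finset.mem_singleton] at h2
    exact h2.symm
  · rw [h.vertices_eq]
    exact extremePoints_convexHull_subset
  · refine ⟨fun h' => h.isProperFace h', fun h' => ?_⟩
    rw [h.vertices_eq] at hσ
    obtain ⟨l, hl, hEq⟩ := (isProperFace_iff h.zero_mem).1 h'
    -- It is enough that `σ` lies in the active set, itself a face of `Δ`.
    exact Δ.down_closed _ ((h.mem_faces _).2 ⟨l, hl, rfl⟩) σ
      ((hull_subset_hull_active_iff (by exact_mod_cast hσ)).1 hEq.subset)

/-! ### Existence of admissible points -/

/-- Take `t • q` with `q` the barycentre of the points of `σ` and `t` slightly above 1. Normals of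
facets through `σ` equal 1 at `q`; the others, finitely many, are below 1 there and remain so. -/
theorem exists_isStellarPoint (h : P.Realizes Δ) (hn : 1 ≤ n) {σ : Finset V} (hσ : σ ∈ Δ.faces)
    (hne : σ.Nonempty) : ∃ p, P.IsStellarPoint σ p := by
  have hσl := h.subset_labels hσ
  have hk : (0 : ℝ) < σ.card := by exact_mod_cast hne.card_pos
  set q : Fin n → ℝ := (σ.card : ℝ)⁻¹ • ∑ v ∈ σ, P.point v with hq
  have hval : ∀ m : StrongDual ℝ (Fin n → ℝ),
      m q = (σ.card : ℝ)⁻¹ * ∑ v ∈ σ, m (P.point v) := fun m => by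
    rw [hq, map_smul, map_sum, smul_eq_mul]
  have hq1 : ∀ m, σ ⊆ P.active m → m q = 1 := by
    intro m hm
    rw [hval, Finset.sum_congr rfl fun v hv => (mem_active.1 (hm hv)).2, Finset.sum_const,
      nsmul_eq_mul, mul_one, inv_mul_cancel₀ hk.ne']
  have hq2 : ∀ m ∈ P.dualBody, ¬ σ ⊆ P.active m → m q < 1 := by
    intro m hm hnot
    obtain ⟨v, hv, hva⟩ := Finset.not_subset.1 hnot
    have hlt : ∑ v ∈ σ, m (P.point v) < ∑ _v ∈ σ, (1 : ℝ) :=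
      Finset.sum_lt_sum (fun w hw => hm w (hσl hw)) ⟨v, hv, lt_of_le_of_ne (hm v (hσl hv))
        fun h1 => hva (mem_active.2 ⟨hσl hv, h1⟩)⟩
    rw [Finset.sum_const, nsmul_eq_mul, mul_one] at hlt
    rw [hval, inv_mul_lt_one₀ hk]
    exact hlt
  have hev : ∀ᶠ t : ℝ in 𝓝 1, ∀ m ∈ {m | P.IsFacetNormal m}, ¬ σ ⊆ P.active m → t * m q < 1 := by
    rw [Filter.eventually_all_finite P.finite_facetNormals]
    intro m hm
    by_cases hs : σ ⊆ P.active m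
    · exact Eventually.of_forall fun _ h' => absurd hs h'
    · have ht : Tendsto (fun t : ℝ => t * m q) (𝓝 1) (𝓝 (1 * m q)) :=
        Continuous.tendsto (by fun_prop) 1
      rw [one_mul] at ht
      exact (ht.eventually_lt_const (hq2 m hm.mem hs)).mono fun _ h' _ => h'
  obtain ⟨t, ht, ht1⟩ := ((hev.filter_mono nhdsWithin_le_nhds).and
    (self_mem_nhdsWithin : Set.Ioi (1 : ℝ) ∈ 𝓝[>] 1)).exists
  refine ⟨t • q, (isStellarPoint_iff hn h.zero_mem hσl).2 ⟨h.isProperFace hσ, fun m hm => ⟨?_, ?_⟩⟩⟩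
  · intro hs
    rw [map_smul, smul_eq_mul, hq1 m hs, mul_one]
    exact ht1
  · intro hs
    rw [map_smul, smul_eq_mul]
    exact ht m hm hs

end Realizes

/-! ### Stellar subdivision of a realization -/

section AddVertex

variable [DecidableEq V] {v : V} {p : Fin n → ℝ}

theorem point_addVertex_of_mem (hv : v ∉ P.labels) {u : V} (hu : u ∈ P.labels) :
    (P.addVertex v p).point u = P.point u :=
  Function.update_of_ne (ne_of_mem_of_not_mem hu hv) _ _

theorem point_addVertex_self : (P.addVertex v p).point v = p := Function.update_self _ _ _

theorem mem_dualBody_addVertex (hv : v ∉ P.labels) :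
    l ∈ (P.addVertex v p).dualBody ↔ l ∈ P.dualBody ∧ l p ≤ 1 := by
  constructor
  · intro h
    refine ⟨fun u hu => ?_, ?_⟩
    · have := h u (Finset.mem_insert_of_mem hu)
      rwa [point_addVertex_of_mem hv hu] at this
    · have := h v (Finset.mem_insert_self _ _)
      rwa [point_addVertex_self] at this
  · rintro ⟨h, hp⟩ u hu
    rcases Finset.mem_insert.1 hu with rfl | hu
    · rwa [point_addVertex_self]
    · rw [point_addVertex_of_mem hv hu]
      exact h u hu

theorem mem_active_addVertex (hv : v ∉ P.labels) {u : V} :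
    u ∈ (P.addVertex v p).active l ↔ (u = v ∧ l p = 1) ∨ u ∈ P.active l := by
  rw [mem_active, mem_active]
  by_cases huv : u = v
  · subst huv
    simp [hv, addVertex]
  · by_cases hu : u ∈ P.labels
    · rw [point_addVertex_of_mem hv hu]
      simp [huv, addVertex]
    · simp [huv, hu, addVertex]

theorem active_addVertex_of_eq (hv : v ∉ P.labels) (hl : l p = 1) :
    (P.addVertex v p).active l = insert v (P.active l) := by
  ext u
  rw [mem_active_addVertex hv, Finset.mem_insert]
  simp [hl]

theorem active_addVertex_of_ne (hv : v ∉ P.labels) (hl : l p ≠ 1) :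
    (P.addVertex v p).active l = P.active l := by
  ext u
  rw [mem_active_addVertex hv]
  simp [hl]

theorem polytope_subset_addVertex (hv : v ∉ P.labels) :
    P.polytope ⊆ (P.addVertex v p).polytope := by
  refine convexHull_mono ?_
  rintro _ ⟨u, hu, rfl⟩
  exact ⟨u, Finset.mem_coe.2 (Finset.mem_insert_of_mem hu), point_addVertex_of_mem hv hu⟩

variable {σ : Finset V}

theorem one_lt_of_subset_active (h0 : (0 : Fin n → ℝ) ∈ interior P.polytope)
    (hp : ∀ m, P.IsFacetNormal m → σ ⊆ P.active m → 1 < m p) (hl : l ∈ P.dualBody) :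
    σ ⊆ P.active l → 1 < l p := by
  refine dualBody_induction (p := fun l => σ ⊆ P.active l → 1 < l p) h0 hp ?_ hl
  intro l hl m hm ihl ihm a b ha hb hab hσ
  rw [active_combo hl hm ha hb hab, Finset.subset_inter_iff] at hσ
  have h1 := ihl hσ.1
  have h2 := ihm hσ.2
  change 1 < a * l p + b * m p
  nlinarith

/-- A combination with value at least 1 at `p` has an endpoint with value at least 1, and that
endpoint's active set is larger. This shows that every face at or above level 1 lies in the closed
star of `σ`. -/
theorem union_subset_active_of_one_le (h0 : (0 : Fin n → ℝ) ∈ interior P.polytope)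
    (hp : ∀ m, P.IsFacetNormal m → ¬ σ ⊆ P.active m → m p < 1) (hl : l ∈ P.dualBody) :
    1 ≤ l p → ∃ m ∈ P.dualBody, σ ∪ P.active l ⊆ P.active m := by
  refine dualBody_induction
    (p := fun l => 1 ≤ l p → ∃ m ∈ P.dualBody, σ ∪ P.active l ⊆ P.active m) h0 ?_ ?_ hl
  · intro m hm h1
    by_cases hs : σ ⊆ P.active m
    · exact ⟨m, hm.mem, Finset.union_subset hs subset_rfl⟩
    · exact absurd (hp m hm hs) h1.not_gt
  · intro l hl m hm ihl ihm a b ha hb hab h1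
    rw [active_combo hl hm ha hb hab]
    change 1 ≤ a * l p + b * m p at h1
    have : 1 ≤ l p ∨ 1 ≤ m p := by
      by_contra! hcon
      nlinarith [hcon.1, hcon.2]
    rcases this with h | h
    · obtain ⟨k, hk, hsub⟩ := ihl h
      exact ⟨k, hk, (Finset.union_subset_union subset_rfl Finset.inter_subset_left).trans hsub⟩
    · obtain ⟨k, hk, hsub⟩ := ihm h
      exact ⟨k, hk, (Finset.union_subset_union subset_rfl Finset.inter_subset_right).trans hsub⟩

theorem exists_lt_one_of_not_subset (h0 : (0 : Fin n → ℝ) ∈ interior P.polytope)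
    (hp : ∀ m, P.IsFacetNormal m → ¬ σ ⊆ P.active m → m p < 1) (hl : l ∈ P.dualBody) :
    ¬ σ ⊆ P.active l → ∃ m ∈ P.dualBody, P.active l ⊆ P.active m ∧ m p < 1 := by
  refine dualBody_induction
    (p := fun l => ¬ σ ⊆ P.active l → ∃ m ∈ P.dualBody, P.active l ⊆ P.active m ∧ m p < 1)
    h0 ?_ ?_ hl
  · exact fun m hm hs => ⟨m, hm.mem, subset_rfl, hp m hm hs⟩
  · intro l hl m hm ihl ihm a b ha hb hab hs
    rw [active_combo hl hm ha hb hab] at hs ⊢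
    rw [Finset.subset_inter_iff, not_and_or] at hs
    rcases hs with h | h
    · obtain ⟨k, hk, hsub, hlt⟩ := ihl h
      exact ⟨k, hk, Finset.inter_subset_left.trans hsub, hlt⟩
    · obtain ⟨k, hk, hsub, hlt⟩ := ihm h
      exact ⟨k, hk, Finset.inter_subset_right.trans hsub, hlt⟩

/-- A face that does not contain `σ` is cut out by a hyperplane with `p` strictly below it. -/
theorem exists_active_eq_lt_one (h0 : (0 : Fin n → ℝ) ∈ interior P.polytope)
    (hp : ∀ m, P.IsFacetNormal m → ¬ σ ⊆ P.active m → m p < 1) (hl : l ∈ P.dualBody)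
    (hσ : ¬ σ ⊆ P.active l) : ∃ k ∈ P.dualBody, P.active k = P.active l ∧ k p < 1 := by
  obtain ⟨m, hm, hsub, hlt⟩ := exists_lt_one_of_not_subset h0 hp hl hσ
  -- Start at `m` and move slightly towards `l`: the value at `p` stays below 1, while the active
  -- set drops at once to that of `l`.
  have ht : Tendsto (fun t : ℝ => (1 - t) * m p + t * l p) (𝓝 0)
      (𝓝 ((1 - 0) * m p + 0 * l p)) := Continuous.tendsto (by fun_prop) 0
  rw [sub_zero, one_mul, zero_mul, add_zero] at ht
  obtain ⟨t, ⟨h1, h2⟩, h3⟩ := ((((ht.eventually_lt_const hlt).and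
    (eventually_lt_nhds zero_lt_one)).filter_mono nhdsWithin_le_nhds).and
    (self_mem_nhdsWithin : Set.Ioi (0 : ℝ) ∈ 𝓝[>] 0)).exists
  have h3' : 0 < t := h3
  refine ⟨(1 - t) • m + t • l, convex_dualBody hm hl (by linarith) h3'.le (by ring), ?_, h1⟩
  rw [active_combo hm hl (by linarith) h3' (by ring)]
  exact Finset.inter_eq_right.2 hsub

/-- Old faces that survive are cut out strictly below level 1 at `p`; new faces come from
functionals of level exactly 1, found on segments that cross this hyperplane. -/
theorem Realizes.addVertex (h : P.Realizes Δ) (hn : 1 ≤ n) (hv : v ∉ P.labels)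
    (hσ : σ ∈ Δ.faces) (hcard : 2 ≤ σ.card) (hp : P.IsStellarPoint σ p) :
    (P.addVertex v p).Realizes (Δ.stellarSubdivision σ v) := by
  have h0 := h.zero_mem
  have hst := ((isStellarPoint_iff hn h0 (h.subset_labels hσ)).1 hp).2
  have hbeyond := fun m hm => (hst m hm).1
  have hbeneath := fun m hm => (hst m hm).2
  have hvΔ : v ∉ Δ.vertices := by
    rw [h.vertices_eq]
    exact hv
  have hva : ∀ l, v ∉ P.active l := fun l hva => hv (active_subset hva)
  have hnot : ∀ l ∈ P.dualBody, l p ≤ 1 → ¬ σ ⊆ P.active l := fun l hl hle hs =>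
    hle.not_gt (one_lt_of_subset_active h0 hbeyond hl hs)
  have hunion : ∀ l ∈ P.dualBody, 1 ≤ l p → σ ∪ P.active l ∈ Δ.faces := by
    intro l hl h1
    obtain ⟨m, hm, hsub⟩ := union_subset_active_of_one_le h0 hbeneath hl h1
    exact Δ.down_closed _ ((h.mem_faces _).2 ⟨m, hm, rfl⟩) _ hsub
  refine ⟨interior_mono (polytope_subset_addVertex hv) h0, ?_, ?_, ?_⟩
  · intro l hl
    obtain ⟨hl, hle⟩ := (mem_dualBody_addVertex hv).1 hl
    have hold : LinearIndepOn ℝ (P.addVertex v p).point (P.active l : Set V) :=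
      (linearIndepOn_congr fun u hu => point_addVertex_of_mem hv (active_subset hu)).2
        (h.linearIndepOn l hl)
    by_cases h1 : l p = 1
    · rw [active_addVertex_of_eq hv h1, Finset.coe_insert]
      refine hold.insert ?_
      rw [point_addVertex_self]
      -- `k - l` vanishes on the old active points but is positive at `p`, so `p` is outside their
      -- span.
      obtain ⟨k, hk, hka⟩ := (h.mem_faces _).1 (hunion l hl h1.ge)
      have hkp : 1 < k p := one_lt_of_subset_active h0 hbeyond hk
        (hka ▸ Finset.subset_union_left)
      intro hspan
      have hle : Submodule.span ℝ ((P.addVertex v p).point '' (P.active l : Set V)) ≤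
          ((k - l : StrongDual ℝ (Fin n → ℝ)) : (Fin n → ℝ) →ₗ[ℝ] ℝ).ker := by
        rw [Submodule.span_le]
        rintro _ ⟨u, hu, rfl⟩
        have huk : u ∈ P.active k := hka ▸ Finset.mem_union_right _ hu
        simp [point_addVertex_of_mem hv (active_subset hu), (mem_active.1 hu).2,
          (mem_active.1 huk).2]
      have := hle hspan
      simp only [LinearMap.mem_ker, ContinuousLinearMap.coe_coe,
        _root_.sub_apply, h1] at this
      linarith
    · rwa [active_addVertex_of_ne hv h1]
  · intro τ
    rw [FaceComplex.mem_stellarSubdivision_iff hσ hvΔ]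
    constructor
    · rintro ⟨hστ, ⟨-, hτ⟩ | ⟨hvτ, hτ⟩⟩
      · obtain ⟨l, hl, rfl⟩ := (h.mem_faces τ).1 hτ
        obtain ⟨k, hk, hka, hkp⟩ := exists_active_eq_lt_one h0 hbeneath hl hστ
        refine ⟨k, (mem_dualBody_addVertex hv).2 ⟨hk, hkp.le⟩, ?_⟩
        rw [active_addVertex_of_ne hv hkp.ne, hka]
      · obtain ⟨l, hl, hla⟩ := (h.mem_faces _).1
          (Δ.down_closed _ hτ (τ.erase v) Finset.subset_union_right)
        obtain ⟨k, hk, hka, hkp⟩ := exists_active_eq_lt_one h0 hbeneath hl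
          (hla ▸ fun hs => hστ (hs.trans (Finset.erase_subset _ _)))
        obtain ⟨m, hm, hma⟩ := (h.mem_faces _).1 hτ
        have hmp : 1 < m p := one_lt_of_subset_active h0 hbeyond hm
          (hma ▸ Finset.subset_union_left)
        have hd : 0 < m p - k p := by linarith
        -- The weights of the point where the segment from `k` to `m` crosses level 1 at `p`. Its
        -- old active set is the intersection of those of `k` and `m`, namely `τ.erase v`.
        set a := (m p - 1) / (m p - k p) with ha
        set b := (1 - k p) / (m p - k p) with hb
        have ha0 : 0 < a := div_pos (by linarith) hd
        have hb0 : 0 < b := div_pos (by linarith) hd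
        have hab : a + b = 1 := by
          rw [ha, hb, ← add_div, div_eq_one_iff_eq hd.ne']
          ring
        have hval : (a • k + b • m) p = 1 := by
          change a * k p + b * m p = 1
          rw [ha, hb]
          field_simp
          ring
        refine ⟨a • k + b • m, (mem_dualBody_addVertex hv).2
          ⟨convex_dualBody hk hm ha0.le hb0.le hab, hval.le⟩, ?_⟩
        rw [active_addVertex_of_eq hv hval, active_combo hk hm ha0 hb0 hab, hka, hla, hma,
          Finset.inter_eq_left.2 Finset.subset_union_right, Finset.insert_erase hvτ]
    · rintro ⟨l, hl, rfl⟩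
      obtain ⟨hl, hle⟩ := (mem_dualBody_addVertex hv).1 hl
      by_cases h1 : l p = 1
      · rw [active_addVertex_of_eq hv h1]
        refine ⟨fun hs => hnot l hl hle ?_, Or.inr ⟨Finset.mem_insert_self _ _, ?_⟩⟩
        · exact (Finset.subset_insert_iff_of_notMem
            fun hvσ => hv (h.subset_labels hσ hvσ)).1 hs
        · rw [Finset.erase_insert (hva l)]
          exact hunion l hl h1.ge
      · rw [active_addVertex_of_ne hv h1]
        exact ⟨hnot l hl hle, Or.inl ⟨hva l, (h.mem_faces _).2 ⟨l, hl, rfl⟩⟩⟩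
  · intro u hu
    rw [FaceComplex.mem_stellarSubdivision_iff hσ hvΔ]
    refine ⟨fun hs => ?_, ?_⟩
    -- Here `2 ≤ σ.card` matters: subdividing at a vertex would delete that vertex.
    · have := Finset.card_le_card hs
      rw [Finset.card_singleton] at this
      omega
    · by_cases huv : u = v
      · subst huv
        refine Or.inr ⟨Finset.mem_singleton_self _, ?_⟩
        rwa [Finset.erase_singleton, Finset.union_empty]
      · refine Or.inl ⟨by simpa [eq_comm] using huv, h.singleton_mem u ?_⟩
        exact Finset.mem_of_mem_insert_of_ne hu huv

end AddVertex

end LabelledPoints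

end ExtNested

namespace ExtNested

open LabelledPoints

/-! ### The cross polytope -/

section CrossPolytope

variable {n : ℕ} {l : StrongDual ℝ (Fin n → ℝ)}

theorem inl_mem_labels_crossPolytope {I : Finset (Fin n)} :
    Sum.inl I ∈ (crossPolytope n).labels ↔ ∃ i, {i} = I := by
  simp [crossPolytope]

theorem inr_mem_labels_crossPolytope (i : Fin n) :
    Sum.inr i ∈ (crossPolytope n).labels := by
  simp [crossPolytope]

theorem crossPolytope_point_inr (i : Fin n) :
    (crossPolytope n).point (Sum.inr i) = -Pi.single i 1 := rfl

theorem mem_dualBody_crossPolytope :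
    l ∈ (crossPolytope n).dualBody ↔ ∀ i, |l (Pi.single i 1)| ≤ 1 := by
  constructor
  · intro h i
    have h1 := h (Sum.inl {i}) (inl_mem_labels_crossPolytope.2 ⟨i, rfl⟩)
    have h2 := h (Sum.inr i) (inr_mem_labels_crossPolytope i)
    rw [crossPolytope_point_inl] at h1
    rw [crossPolytope_point_inr, map_neg] at h2
    exact abs_le.2 ⟨by linarith, h1⟩
  · rintro h (I | i) hv
    · obtain ⟨i, rfl⟩ := inl_mem_labels_crossPolytope.1 hv
      rw [crossPolytope_point_inl]
      exact (abs_le.1 (h i)).2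
    · rw [crossPolytope_point_inr, map_neg]
      linarith [(abs_le.1 (h i)).1]

theorem inl_mem_active_crossPolytope {I : Finset (Fin n)} :
    Sum.inl I ∈ (crossPolytope n).active l ↔ ∃ i, {i} = I ∧ l (Pi.single i 1) = 1 := by
  rw [mem_active, inl_mem_labels_crossPolytope]
  constructor
  · rintro ⟨⟨i, rfl⟩, h⟩
    rw [crossPolytope_point_inl] at h
    exact ⟨i, rfl, h⟩
  · rintro ⟨i, rfl, h⟩
    rw [crossPolytope_point_inl]
    exact ⟨⟨i, rfl⟩, h⟩

theorem inr_mem_active_crossPolytope {i : Fin n} :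
    Sum.inr i ∈ (crossPolytope n).active l ↔ l (Pi.single i 1) = -1 := by
  rw [mem_active, crossPolytope_point_inr, map_neg, neg_eq_iff_eq_neg]
  exact and_iff_right (inr_mem_labels_crossPolytope i)

/-- The open ℓ¹ unit ball lies in the polytope: a separating functional bounded by `u` on all `±e_i`
satisfies `f x ≤ (∑ |x_i|) * u < u` there. -/
theorem zero_mem_interior_crossPolytope (hn : 1 ≤ n) :
    (0 : Fin n → ℝ) ∈ interior (crossPolytope n).polytope := by
  refine mem_interior.2 ⟨{x | ∑ i, |x i| < 1}, fun x hx => ?_,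
    isOpen_lt (by fun_prop) continuous_const, by simp⟩
  by_contra hxP
  have hclosed : IsClosed (crossPolytope n).polytope :=
    ((Finset.finite_toSet _).image _).isClosed_convexHull ℝ
  obtain ⟨f, u, hf, hu⟩ := geometric_hahn_banach_closed_point (convex_convexHull ℝ _) hclosed hxP
  have habs : ∀ i, |f (Pi.single i 1)| < u := by
    intro i
    have h1 := hf _ (point_mem_hull (inl_mem_labels_crossPolytope.2 ⟨i, rfl⟩))
    have h2 := hf _ (point_mem_hull (inr_mem_labels_crossPolytope i))
    rw [crossPolytope_point_inl] at h1
    rw [crossPolytope_point_inr, map_neg] at h2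
    exact abs_lt.2 ⟨by linarith, h1⟩
  have hu0 : 0 < u := (abs_nonneg _).trans_lt (habs ⟨0, hn⟩)
  have hle : f x ≤ (∑ i, |x i|) * u := by
    have := LinearMap.pi_apply_eq_sum_univ (f : (Fin n → ℝ) →ₗ[ℝ] ℝ) x
    simp only [ContinuousLinearMap.coe_coe, smul_eq_mul] at this
    rw [this, Finset.sum_mul]
    refine Finset.sum_le_sum fun i _ => (le_abs_self _).trans ?_
    rw [abs_mul]
    refine mul_le_mul_of_nonneg_left ?_ (abs_nonneg _)
    have hsingle : (fun j => if i = j then (1 : ℝ) else 0) = Pi.single i 1 := by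
      funext j
      simp [Pi.single_apply, eq_comm]
    rw [hsingle]
    exact (habs i).le
  have hx' : ∑ i, |x i| < 1 := hx
  nlinarith

/-- The sign `l e_i` decides which of `e_i`, `-e_i` can be active, so active points use distinct
coordinates and signed coordinate functionals are dual to them. -/
theorem linearIndepOn_active_crossPolytope (l : StrongDual ℝ (Fin n → ℝ)) :
    LinearIndepOn ℝ (crossPolytope n).point ((crossPolytope n).active l : Set (Label (Fin n))) := by
  have hcases : ∀ v : ((crossPolytope n).active l : Set (Label (Fin n))), ∃ i, ∃ s : ℝ,
      s * s = 1 ∧ l (Pi.single i 1) = s ∧ (crossPolytope n).point v = s • Pi.single i 1 ∧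
      (v : Label (Fin n)) = if s = 1 then Sum.inl {i} else Sum.inr i := by
    rintro ⟨I | i, hv⟩
    · obtain ⟨i, rfl, h⟩ := inl_mem_active_crossPolytope.1 hv
      exact ⟨i, 1, by norm_num, h, by rw [crossPolytope_point_inl, one_smul], by simp⟩
    · refine ⟨i, -1, by norm_num, inr_mem_active_crossPolytope.1 hv, ?_, ?_⟩
      · rw [crossPolytope_point_inr, neg_one_smul]
      · rw [if_neg (by norm_num)]
  choose f s hs hl hpt hv using hcases
  refine LinearIndependent.of_pairwise_dual_eq_zero_one _
    (fun v => s v • (LinearMap.proj (f v) : (Fin n → ℝ) →ₗ[ℝ] ℝ)) ?_ ?_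
  · intro v w hne
    have hfne : f v ≠ f w := by
      intro h
      refine hne (Subtype.ext ?_)
      have hsEq : s v = s w := by rw [← hl v, ← hl w, h]
      rw [hv v, hv w, hsEq, h]
    simp [hpt w, hfne]
  · intro v
    simp [hpt v, hs v]

theorem realizes_crossPolytope (hn : 1 ≤ n) : (crossPolytope n).Realizes (crossComplex n) := by
  refine ⟨zero_mem_interior_crossPolytope hn, fun l _ => linearIndepOn_active_crossPolytope l,
    fun τ => ⟨?_, ?_⟩, ?_⟩
  · rintro ⟨h1, h2⟩
    -- The functional with coefficient 1 where `{i}` is chosen, -1 where `x_i` is, and 0 elsewhere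
    -- is active exactly on `τ`.
    set c : Fin n → ℝ := fun i =>
      if Sum.inl {i} ∈ τ then 1 else if Sum.inr i ∈ τ then -1 else 0 with hc
    let l : StrongDual ℝ (Fin n → ℝ) := ∑ i, c i • ContinuousLinearMap.proj i
    have hl : ∀ i, l (Pi.single i 1) = c i := by
      intro i
      simp [l, Pi.single_apply]
    refine ⟨l, mem_dualBody_crossPolytope.2 fun i => ?_, ?_⟩
    · rw [hl, hc]
      dsimp only
      split_ifs <;> simp
    · ext (I | i)
      · rw [inl_mem_active_crossPolytope]
        constructor
        · rintro ⟨i, rfl, h⟩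
          by_contra hi
          rw [hl, hc] at h
          simp only [if_neg hi] at h
          split_ifs at h <;> norm_num at h
        · intro hI
          obtain ⟨i, rfl⟩ := h1 I hI
          exact ⟨i, rfl, by rw [hl, hc]; simp [hI]⟩
      · rw [inr_mem_active_crossPolytope, hl, hc]
        constructor
        · intro h
          by_contra hi
          simp only [if_neg hi] at h
          split_ifs at h <;> norm_num at h
        · intro hi
          have hnot : Sum.inl {i} ∉ τ := fun h => h2 i ⟨h, hi⟩
          simp [hnot, hi]
  · rintro ⟨l, -, rfl⟩
    refine ⟨fun I hI => ?_, fun i hi => ?_⟩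
    · obtain ⟨i, rfl, -⟩ := inl_mem_active_crossPolytope.1 hI
      exact ⟨i, rfl⟩
    · obtain ⟨j, hj, h⟩ := inl_mem_active_crossPolytope.1 hi.1
      rw [Finset.singleton_inj.1 hj, inr_mem_active_crossPolytope.1 hi.2] at h
      norm_num at h
  · rintro (I | i) hv
    · obtain ⟨i, rfl⟩ := inl_mem_labels_crossPolytope.1 hv
      exact ⟨fun J hJ => ⟨i, by simpa using hJ⟩, by simp⟩
    · exact ⟨by simp, by simp⟩

end CrossPolytope

/-! ### Runs of the subdivision procedure -/

variable {n : ℕ} {B : Finset (Finset (Fin n))} {L L' : List (Finset (Fin n))}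
  {I : Finset (Fin n)}

theorem IsDecreasingOrder.singletonFace_mem (hB : IsBuildingSet B) (hL : IsDecreasingOrder B L)
    (h : L' ++ [I] <+: L) : singletonFace I ∈ (iteratedSubdivision L').faces := by
  have h' : L' <+: L := (List.prefix_append L' [I]).trans h
  rw [hL.iteratedSubdivision_prefix hB h']
  exact singletonFace_mem_extendedNestedComplex (hL.isBuildingSet_prefix hB h')
    (hL.next hB h).2.2

theorem IsDecreasingOrder.notMem_vertices (hB : IsBuildingSet B) (hL : IsDecreasingOrder B L)
    (h : L' ++ [I] <+: L) : Sum.inl I ∉ (iteratedSubdivision L').vertices := by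
  rw [hL.iteratedSubdivision_prefix hB ((List.prefix_append L' [I]).trans h)]
  exact fun hI => (hL.next hB h).1 (IsExtendedNested.mem hI I (Finset.mem_singleton_self _))

/-- The two halves meet here: the nested complex of each prefix shows that the set to subdivide is a
face with at least two vertices and that its label is new, as the geometric step requires. -/
theorem IsStellarRun.realizes (hn : 1 ≤ n) (hB : IsBuildingSet B) (hL : IsDecreasingOrder B L)
    {P : LabelledPoints (Label (Fin n)) n} (hP : IsStellarRun L' P) (h : L' <+: L) :
    P.Realizes (iteratedSubdivision L') := by
  induction hP with
  | nil => exact realizes_crossPolytope hn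
  | @snoc L' P I p _ hp ih =>
    have hR := ih ((List.prefix_append L' [I]).trans h)
    have hv := hL.notMem_vertices hB h
    rw [hR.vertices_eq] at hv
    rw [iteratedSubdivision_concat]
    refine hR.addVertex hn hv (hL.singletonFace_mem hB h) ?_ hp
    rw [card_singletonFace]
    exact (hL.next hB h).2.1

theorem IsStellarRun.exists_isStellarPoint (hn : 1 ≤ n) (hB : IsBuildingSet B)
    (hL : IsDecreasingOrder B L) {P : LabelledPoints (Label (Fin n)) n} (hP : IsStellarRun L' P)
    (h : L' ++ [I] <+: L) : ∃ p, P.IsStellarPoint (singletonFace I) p := by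
  refine (hP.realizes hn hB hL ((List.prefix_append L' [I]).trans h)).exists_isStellarPoint hn
    (hL.singletonFace_mem hB h) (Finset.card_pos.1 ?_)
  rw [card_singletonFace]
  exact zero_lt_two.trans_le (hL.next hB h).2.1

theorem IsDecreasingOrder.exists_isStellarRun (hn : 1 ≤ n) (hB : IsBuildingSet B)
    (hL : IsDecreasingOrder B L) (h : L' <+: L) : ∃ P, IsStellarRun L' P := by
  induction L' using List.reverseRecOn with
  | nil => exact ⟨_, IsStellarRun.nil⟩
  | append_singleton L' I ih =>
    obtain ⟨P, hP⟩ := ih ((List.prefix_append L' [I]).trans h)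
    obtain ⟨p, hp⟩ := hP.exists_isStellarPoint hn hB hL h
    exact ⟨_, hP.snoc hp⟩

theorem exists_isDecreasingOrder (B : Finset (Finset (Fin n))) : ∃ L, IsDecreasingOrder B L := by
  classical
  let r : Finset (Fin n) → Finset (Fin n) → Prop := fun I J => J.card ≤ I.card
  have : Std.Total r := ⟨fun I J => le_total _ _⟩
  have : IsTrans _ r := ⟨fun _ _ _ h1 h2 => h2.trans h1⟩
  have hperm := List.perm_insertionSort r (B.filter fun I => I.card ≠ 1).toList
  refine ⟨List.insertionSort r (B.filter fun I => I.card ≠ 1).toList, ?_, fun I => ?_, ?_⟩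
  · exact hperm.nodup_iff.2 (Finset.nodup_toList _)
  · rw [hperm.mem_iff, Finset.mem_toList, Finset.mem_filter]
  · exact List.pairwise_insertionSort r _

end ExtNested

theorem theorem3p2 (n : ℕ) (hn : 1 ≤ n) (B : Finset (Finset (Fin n))) (hB : IsBuildingSet B) :
    -- the extended nested complex is the boundary complex of a simplicial `n`-polytope
    (∃ (Q : Set (Fin n → ℝ)) (φ : Label (Fin n) → Fin n → ℝ),
      dim Q = n ∧ IsGeometricRealization (extendedNestedComplex B) Q φ) ∧
    -- and the stellar subdivision procedure produces one, for every admissible order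
    ∀ L : List (Finset (Fin n)), IsDecreasingOrder B L →
      -- every step can be carried out, whatever points were chosen before
      (∀ (L' : List (Finset (Fin n))) (I : Finset (Fin n)), L' ++ [I] <+: L →
        singletonFace I ∈ (iteratedSubdivision L').faces ∧
        Sum.inl I ∉ (iteratedSubdivision L').vertices ∧
        ∀ P, IsStellarRun L' P → ∃ p, P.IsStellarPoint (singletonFace I) p) ∧
      -- every intermediate polytope realizes the iterated stellar subdivision
      (∀ (L' : List (Finset (Fin n))), L' <+: L → ∀ P, IsStellarRun L' P →
        dim P.polytope = n ∧
        IsGeometricRealization (iteratedSubdivision L') P.polytope P.point) ∧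
      -- the resulting complex is the extended nested complex
      iteratedSubdivision L = extendedNestedComplex B ∧
      -- and the resulting polytope realizes it, vertex labels being preserved
      (∃ P, IsStellarRun L P) ∧
      ∀ P, IsStellarRun L P →
        dim P.polytope = n ∧
        IsGeometricRealization (extendedNestedComplex B) P.polytope P.point := by
  have main : ∀ L : List (Finset (Fin n)), IsDecreasingOrder B L →
      iteratedSubdivision L = extendedNestedComplex B ∧ (∃ P, IsStellarRun L P) ∧
      ∀ P, IsStellarRun L P → dim P.polytope = n ∧
        IsGeometricRealization (extendedNestedComplex B) P.polytope P.point := by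
    intro L hL
    have hEq : iteratedSubdivision L = extendedNestedComplex B := by
      rw [hL.iteratedSubdivision_prefix hB (List.prefix_refl L), hL.withSingletons_eq hB]
    refine ⟨hEq, hL.exists_isStellarRun hn hB (List.prefix_refl L), fun P hP => ?_⟩
    have hR := hP.realizes hn hB hL (List.prefix_refl L)
    rw [hEq] at hR
    exact ⟨LabelledPoints.dim_polytope hR.zero_mem, hR.isGeometricRealization⟩
  refine ⟨?_, fun L hL => ⟨fun L' I h => ⟨hL.singletonFace_mem hB h, hL.notMem_vertices hB h,
    fun P hP => hP.exists_isStellarPoint hn hB hL h⟩, fun L' h P hP => ?_, main L hL⟩⟩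
  · obtain ⟨L, hL⟩ := exists_isDecreasingOrder B
    obtain ⟨-, ⟨P, hP⟩, h⟩ := main L hL
    exact ⟨P.polytope, P.point, h P hP⟩
  · have hR := hP.realizes hn hB hL h
    exact ⟨LabelledPoints.dim_polytope hR.zero_mem, hR.isGeometricRealization⟩
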